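/- **Theorem 8.1.** Let $P=(P,\le)$ be a partial order, and let $\kappa=\max(|\operatorname{trcl}(P)|,\aleph_1)$, where $\operatorname{trcl}(P)$ is the transitive closure of (the underlying set of) $P$. For an infinite cardinal $\chi$ let $\mathcal H_\chi$ be the set of all sets $x$ with $|\operatorname{trcl}(x)|<\chi$, and let $\mathcal M_\chi$ be the set of all elementary submodels $M$ of $(\mathcal H_\chi,\in)$ such that $|M|=\aleph_1$ and $[M]^{\aleph_0}\cap M$ is cofinal in $([M]^{\aleph_0},\subseteq)$; here $[X]^\lambda$ is the set of subsets of $X$ of cardinality $\lambda$. For $Q\subseteq P$ write $Q\le_\sigma P$ if for every $p\in P$ the set $\{q\in Q:q\le p\}$ has a countable cofinal subset and the set $\{q\in Q:q\ge p\}$ has a countable coinitial subset. Let $\operatorname{SEP}(P)$ be the statement: for all sufficiently large regular cardinals $\chi$, the set $\{M\in\mathcal M_\chi: P\cap M\le_\sigma P\}$ is cofinal in $[\mathcal H_\chi]^{\aleph_1}$, that is, every $X\in[\mathcal H_\chi]^{\aleph_1}$ is included in some member of it. For a regular cardinal $\chi>\kappa$ let $$\mathcal M(P,\chi)=\{M\in\mathcal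 M_\chi:(P,\le)\in M\text{ and }P\cap M\le_\sigma P\}.$$ A set $\mathcal C\subseteq[\mathcal H_\chi]^{\aleph_1}$ is club if it is cofinal in $[\mathcal H_\chi]^{\aleph_1}$ with respect to $\subseteq$ and closed under unions of nonempty $\subseteq$-chains of at most $\aleph_1$ members, and a subset of $[\mathcal H_\chi]^{\aleph_1}$ is stationary if it meets every club. Then the following are equivalent: 1. $\operatorname{SEP}(P)$. 2. There is a regular cardinal $\chi>\kappa$ such that $\mathcal M(P,\chi)$ is stationary in $[\mathcal H_\chi]^{\aleph_1}$. 3. For every regular cardinal $\chi>\kappa$, $\mathcal M(P,\chi)$ is stationary in $[\mathcal H_\chi]^{\aleph_1}$. 4. There is a regular cardinal $\chi>2^\kappa$ such that $\mathcal M(P,\chi)$ is non-empty. 5. For every regular cardinal $\chi>2^\kappa$, $\mathcal M(P,\chi)$ is non-empty. -/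

import Mathlib

open Cardinal

universe u

namespace SepPrinciple

/-! ### Transitive closure and the sets `H_χ` -/

/-- The transitive closure of `x`: `x ∪ ⋃x ∪ ⋃⋃x ∪ ⋯`, the least transitive set including `x`. -/
noncomputable def trcl (x : ZFSet.{u}) : ZFSet.{u} :=
  ZFSet.iUnion fun n : ℕ => ZFSet.sUnion^[n] x

theorem subset_trcl (x : ZFSet.{u}) : x ⊆ trcl x := by
  intro y hy
  exact ZFSet.mem_iUnion.2 ⟨0, hy⟩

theorem isTransitive_trcl (x : ZFSet.{u}) : (trcl x).IsTransitive := by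
  intro y hy z hz
  obtain ⟨n, hn⟩ := ZFSet.mem_iUnion.1 hy
  refine ZFSet.mem_iUnion.2 ⟨n + 1, ?_⟩
  rw [Function.iterate_succ_apply']
  exact ZFSet.mem_sUnion.2 ⟨y, hn, hz⟩

theorem trcl_subset {x t : ZFSet.{u}} (hx : x ⊆ t) (ht : t.IsTransitive) : trcl x ⊆ t := by
  intro y hy
  obtain ⟨n, hn⟩ := ZFSet.mem_iUnion.1 hy
  induction n generalizing y with
  | zero => exact hx hn
  | succ n ih =>
    rw [Function.iterate_succ_apply'] at hn
    obtain ⟨z, hz, hyz⟩ := ZFSet.mem_sUnion.1 hn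
    exact ht z (ih (ZFSet.mem_iUnion.2 ⟨n, hz⟩) hz) hyz

/-- `H_χ`, the collection of all sets whose transitive closure has cardinality less than `χ`. -/
def H (χ : Cardinal.{u}) : Set ZFSet.{u} :=
  {x | (trcl x).card < χ}

/-! ### The first-order structure `(H_χ, ∈)` and its elementary submodels -/

/-- The only non-logical symbol of the language of set theory: a binary relation symbol. -/
inductive MemRel : ℕ → Type
  | mem : MemRel 2

/-- The first-order language of set theory. -/
def langSet : FirstOrder.Language.{0, 0} :=
  ⟨fun _ => Empty, MemRel⟩

/-- The membership symbol. -/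
def memSymbol : langSet.Relations 2 :=
  MemRel.mem

/-- Every collection of sets is a structure for the language of set theory, with the membership
relation. -/
instance memStructure (X : Set ZFSet.{u}) : langSet.Structure X where
  funMap := fun f => nomatch f
  RelMap := fun {_} r =>
    match r with
    | MemRel.mem => fun v => ((v 0 : X) : ZFSet.{u}) ∈ ((v 1 : X) : ZFSet.{u})

theorem relMap_memSymbol (X : Set ZFSet.{u}) (v : Fin 2 → X) :
    FirstOrder.Language.Structure.RelMap memSymbol v ↔
      ((v 0 : X) : ZFSet.{u}) ∈ ((v 1 : X) : ZFSet.{u}) :=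
  Iff.rfl

/-- `M ≼ X`, where `M` and `X` carry the membership relation. -/
def IsElementarySubmodel (M X : Set ZFSet.{u}) : Prop :=
  ∃ S : langSet.ElementarySubstructure X, M = Subtype.val '' (S : Set X)

/-! ### `[X]^κ`, cofinal, club and stationary subsets -/

/-- `[X]^κ`, the collection of all subsets of `X` of cardinality exactly `κ`. -/
def subsetsOfCard (X : Set ZFSet.{u}) (κ : Cardinal.{u + 1}) : Set (Set ZFSet.{u}) :=
  {Y | Y ⊆ X ∧ #Y = κ}

/-- Every member of `𝒳` is included in some member of `𝒮`. -/
def CofinalIn (𝒮 𝒳 : Set (Set ZFSet.{u})) : Prop :=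
  ∀ Y ∈ 𝒳, ∃ M ∈ 𝒮, Y ⊆ M

/-- `𝒞` is closed unbounded in `[X]^ℵ₁`: it is a cofinal subset of `[X]^ℵ₁` which is closed under
unions of nonempty chains of at most `ℵ₁` members. -/
def IsClub (X : Set ZFSet.{u}) (𝒞 : Set (Set ZFSet.{u})) : Prop :=
  𝒞 ⊆ subsetsOfCard X ℵ₁ ∧
  CofinalIn 𝒞 (subsetsOfCard X ℵ₁) ∧
  ∀ 𝒟 ⊆ 𝒞, 𝒟.Nonempty → IsChain (· ⊆ ·) 𝒟 → #𝒟 ≤ ℵ₁ → ⋃₀ 𝒟 ∈ 𝒞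

/-- `𝒮` is stationary in `[X]^ℵ₁`: it meets every closed unbounded subset of `[X]^ℵ₁`. -/
def IsStationary (X : Set ZFSet.{u}) (𝒮 : Set (Set ZFSet.{u})) : Prop :=
  𝒮 ⊆ subsetsOfCard X ℵ₁ ∧ ∀ 𝒞, IsClub X 𝒞 → (𝒮 ∩ 𝒞).Nonempty

/-! ### Good elementary submodels -/

/-- `[M]^ℵ₀ ∩ M`: the countably infinite subsets of `M` that are elements of `M`. -/
def countableMembers (M : Set ZFSet.{u}) : Set (Set ZFSet.{u}) :=
  {Y | Y ∈ subsetsOfCard M ℵ₀ ∧ ∃ y ∈ M, (y : Set ZFSet.{u}) = Y}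

/-- `ℳ_χ`: the elementary submodels `M` of `H_χ` of cardinality `ℵ₁` for which `[M]^ℵ₀ ∩ M` is
cofinal in `[M]^ℵ₀`. -/
def goodModels (χ : Cardinal.{u}) : Set (Set ZFSet.{u}) :=
  {M | IsElementarySubmodel M (H χ) ∧ #M = ℵ₁ ∧
    CofinalIn (countableMembers M) (subsetsOfCard M ℵ₀)}

/-! ### Partial orders that are sets -/

/-- A partial order in the universe of sets: an underlying set together with a (reflexive) partial
order relation on it, given as a set of ordered pairs. -/
structure SetPoset : Type (u + 1) where
  /-- the underlying set -/
  carrier : ZFSet.{u}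
  /-- the order relation -/
  rel : ZFSet.{u}
  rel_subset : rel ⊆ ZFSet.prod carrier carrier
  refl : ∀ x ∈ carrier, ZFSet.pair x x ∈ rel
  antisymm : ∀ x y, ZFSet.pair x y ∈ rel → ZFSet.pair y x ∈ rel → x = y
  trans : ∀ x y z, ZFSet.pair x y ∈ rel → ZFSet.pair y z ∈ rel → ZFSet.pair x z ∈ rel

namespace SetPoset

variable (P : SetPoset.{u})

/-- The partial order as a single set, the ordered pair of the underlying set and the relation. -/
def code : ZFSet.{u} :=
  ZFSet.pair P.carrier P.rel

/-- `p ≤ q` in `P`. -/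
def Le (p q : ZFSet.{u}) : Prop :=
  ZFSet.pair p q ∈ P.rel

/-- `Q ≤_σ P` for a suborder `Q` of `P`, given by its underlying set: for every `p ∈ P`, the set
`{q ∈ Q : q ≤ p}` has a countable cofinal subset and the set `{q ∈ Q : p ≤ q}` has a countable
coinitial subset. -/
def LeSigma (Q : Set ZFSet.{u}) : Prop :=
  Q ⊆ (P.carrier : Set ZFSet.{u}) ∧
  ∀ p ∈ P.carrier,
    (∃ C ⊆ {q ∈ Q | P.Le q p}, C.Countable ∧ ∀ q ∈ Q, P.Le q p → ∃ c ∈ C, P.Le q c) ∧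
    (∃ C ⊆ {q ∈ Q | P.Le p q}, C.Countable ∧ ∀ q ∈ Q, P.Le p q → ∃ c ∈ C, P.Le c q)

/-- `SEP(P)`: for all sufficiently large regular `χ`, the `M ∈ ℳ_χ` with `P ∩ M ≤_σ P` are cofinal
in `[H_χ]^ℵ₁`. -/
def SEP : Prop :=
  ∃ χ₀ : Cardinal.{u}, ∀ χ : Cardinal.{u}, χ.IsRegular → χ₀ ≤ χ →
    CofinalIn {M ∈ goodModels χ | P.LeSigma ((P.carrier : Set ZFSet.{u}) ∩ M)}
      (subsetsOfCard (H χ) ℵ₁)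

/-- `ℳ(P, χ)`: the `M ∈ ℳ_χ` with `P ∈ M` (as a structure) and `P ∩ M ≤_σ P`. -/
def models (χ : Cardinal.{u}) : Set (Set ZFSet.{u}) :=
  {M ∈ goodModels χ | P.code ∈ M ∧ P.LeSigma ((P.carrier : Set ZFSet.{u}) ∩ M)}

/-- `κ = max(|trcl(P)|, ℵ₁)`. -/
noncomputable def kappa : Cardinal.{u} :=
  max (trcl P.carrier).card ℵ₁

end SetPoset

end SepPrinciple

/-
The five conditions are linked by a reflection property that does not mention `χ`: given a set `D`
including `P`, every relation `R` total on `D` has a set `N ⊆ D` of size `ℵ₁` that is closed under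
pairing and under a choice of `R`-images, whose countable subsets are covered by its countable
elements, and which satisfies `P ∩ N ≤_σ P`.

A model in `M(P, χ)` closed under a choice function for `R` is such an `N`, so stationarity of
`M(P, χ)` gives reflection on `H_χ`. If `χ > 2^κ`, then `H_{κ⁺} ∈ H_χ`, because `|H_{κ⁺}| ≤ 2^κ`;
all `R` on `H_{κ⁺}` and all candidates for `N` lie in `H_χ`, so if reflection on `H_{κ⁺}` failed,
then by elementarity a model in `M(P, χ)` would contain a relation `R` witnessing the failure, while
its own trace on `H_{κ⁺}` reflects `R`.

Conversely, given a club `C` in `[H_χ]^{ℵ₁}`, assign to each set `d` a countable `V d ≺ H_χ`, by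
recursion on rank, so that the unions of the `V d` along such an `N` are again elementary and
countably covered; reflecting a relation on `D` which chases the elements of `P` in the `V d` makes
the union meet `P` exactly in `P ∩ N`. Closing the union off under a monotone choice of members of
`C` makes it the union of a σ-directed family of size `ℵ₁` in `C`, hence a member of `C`.
-/

namespace SepPrinciple

open ZFSet Ordinal

theorem trcl_mono {x y : ZFSet.{u}} (h : x ⊆ y) : trcl x ⊆ trcl y :=
  trcl_subset (fun _ hz => subset_trcl y (h hz)) (isTransitive_trcl y)

theorem trcl_subset_of_mem {x y : ZFSet.{u}} (h : y ∈ x) : trcl y ⊆ trcl x :=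
  trcl_subset (isTransitive_trcl x y (subset_trcl x h)) (isTransitive_trcl x)

theorem mk_coe (x : ZFSet.{u}) : #(x : Set ZFSet.{u}) = lift.{u + 1} x.card :=
  cardinalMk_coe_sort

theorem countable_coe_iff {x : ZFSet.{u}} : (x : Set ZFSet.{u}).Countable ↔ x.card ≤ ℵ₀ := by
  rw [← Cardinal.le_aleph0_iff_set_countable, mk_coe, Cardinal.lift_le_aleph0]

theorem exists_coe_eq (A : Set ZFSet.{u}) [Small.{u} A] :
    ∃ z : ZFSet.{u}, (z : Set ZFSet.{u}) = A :=
  ⟨ZFSet.range (Subtype.val : A → ZFSet.{u}), by simp⟩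

theorem exists_coe_eq_of_subset {A : Set ZFSet.{u}} {x : ZFSet.{u}} (hA : A ⊆ x) :
    ∃ z : ZFSet.{u}, (z : Set ZFSet.{u}) = A :=
  ⟨x.sep (· ∈ A), by ext z; simpa using @hA z⟩

theorem card_prod_le (x y : ZFSet.{u}) : (prod x y).card ≤ x.card * y.card := by
  have hsub : (prod x y : Set ZFSet.{u}) ⊆ (fun p : ZFSet.{u} × ZFSet.{u} => pair p.1 p.2) ''
      ((x : Set ZFSet.{u}) ×ˢ (y : Set ZFSet.{u})) := by
    intro z hz
    obtain ⟨a, ha, b, hb, rfl⟩ := mem_prod.1 hz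
    exact ⟨(a, b), ⟨ha, hb⟩, rfl⟩
  have hle := (Cardinal.mk_le_mk_of_subset hsub).trans Cardinal.mk_image_le
  rwa [Cardinal.mk_setProd, mk_coe, mk_coe, mk_coe, ← Cardinal.lift_mul, Cardinal.lift_le] at hle

theorem mem_H_of_subset_isTransitive {χ : Cardinal.{u}} {x t : ZFSet.{u}} (hx : x ⊆ t)
    (ht : t.IsTransitive) (hc : t.card < χ) : x ∈ H χ :=
  (card_mono (trcl_subset hx ht)).trans_lt hc

theorem mem_H_of_mem {χ : Cardinal.{u}} {x y : ZFSet.{u}} (hx : x ∈ H χ) (hy : y ∈ x) : y ∈ H χ :=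
  (card_mono (trcl_subset_of_mem hy)).trans_lt hx

theorem mem_H_of_subset {χ : Cardinal.{u}} {x y : ZFSet.{u}} (hx : x ∈ H χ) (hy : y ⊆ x) :
    y ∈ H χ :=
  (card_mono (trcl_mono hy)).trans_lt hx

theorem card_lt_of_mem_H {χ : Cardinal.{u}} {x : ZFSet.{u}} (hx : x ∈ H χ) : x.card < χ :=
  (card_mono (subset_trcl x)).trans_lt hx

theorem mem_H_of_forall_mem {χ : Cardinal.{u}} (hχ : χ.IsRegular) {x : ZFSet.{u}}
    (hc : x.card < χ) (hx : ∀ y ∈ x, y ∈ H χ) : x ∈ H χ := by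
  let U : ZFSet.{u} := ZFSet.iUnion fun y : Shrink.{u} x => trcl ((equivShrink x).symm y).1
  have hU : ∀ z, z ∈ U ↔ ∃ y ∈ x, z ∈ trcl y := fun z =>
    ZFSet.mem_iUnion.trans (((equivShrink x).symm.exists_congr_left).trans (by simp))
  have htrans : (x ∪ U).IsTransitive := by
    intro y hy z hz
    refine mem_union.2 (Or.inr ((hU z).2 ?_))
    rcases mem_union.1 hy with hyx | hyU
    · exact ⟨y, hyx, subset_trcl y hz⟩
    · obtain ⟨w, hw, hyw⟩ := (hU y).1 hyU
      exact ⟨w, hw, isTransitive_trcl w y hyw hz⟩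
  have hcU : U.card < χ := by
    have hle := lift_card_iUnion_le_sum_card.{u, u}
      (f := fun y : Shrink.{u} x => trcl ((equivShrink x).symm y).1)
    rw [Cardinal.lift_id] at hle
    exact hle.trans_lt (Cardinal.sum_lt_of_isRegular hχ hc fun i =>
      hx _ ((equivShrink x).symm i).2)
  exact mem_H_of_subset_isTransitive (fun z hz => mem_union.2 (Or.inl hz)) htrans
    (card_union_le.trans_lt (add_lt_of_lt hχ.aleph0_le hc hcU))

/-- `X` contains, as elements, all its countable subsets. -/
def IsCountablyClosed (X : Set ZFSet.{u}) : Prop :=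
  ∀ y : ZFSet.{u}, (y : Set ZFSet.{u}) ⊆ X → (y : Set ZFSet.{u}).Countable → y ∈ X

theorem isCountablyClosed_H {χ : Cardinal.{u}} (hχ : χ.IsRegular) (h : ℵ₀ < χ) :
    IsCountablyClosed (H χ) := fun _ hy hc =>
  mem_H_of_forall_mem hχ ((countable_coe_iff.1 hc).trans_lt h) hy

theorem IsCountablyClosed.doubleton_mem {X : Set ZFSet.{u}} (hX : IsCountablyClosed X)
    {a b : ZFSet.{u}} (ha : a ∈ X) (hb : b ∈ X) : ({a, b} : ZFSet.{u}) ∈ X := by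
  have hab : (({a, b} : ZFSet.{u}) : Set ZFSet.{u}) = {a, b} := by ext; simp
  refine hX _ ?_ ?_ <;> rw [hab]
  · rintro z (rfl | rfl) <;> assumption
  · exact (Set.countable_singleton _).insert _

theorem IsCountablyClosed.pair_mem {X : Set ZFSet.{u}} (hX : IsCountablyClosed X)
    {a b : ZFSet.{u}} (ha : a ∈ X) (hb : b ∈ X) : pair a b ∈ X := by
  have ha' := hX.doubleton_mem ha ha
  rw [pair_eq_singleton] at ha'
  exact hX.doubleton_mem ha' (hX.doubleton_mem ha hb)

theorem prod_mem_H {χ : Cardinal.{u}} (hχ : χ.IsRegular) (h : ℵ₀ < χ) {x y : ZFSet.{u}}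
    (hx : x ∈ H χ) (hy : y ∈ H χ) : prod x y ∈ H χ := by
  refine mem_H_of_forall_mem hχ ((card_prod_le x y).trans_lt
    (Cardinal.mul_lt_of_lt hχ.aleph0_le (card_lt_of_mem_H hx) (card_lt_of_mem_H hy))) ?_
  intro z hz
  obtain ⟨a, ha, b, hb, rfl⟩ := mem_prod.1 hz
  exact (isCountablyClosed_H hχ h).pair_mem (mem_H_of_mem hx ha) (mem_H_of_mem hy hb)

theorem toZFSet_mem_H {χ : Cardinal.{u}} {o : Ordinal.{u}} (h : o.card < χ) : o.toZFSet ∈ H χ :=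
  mem_H_of_subset_isTransitive (fun _ h => h) (ZFSet.isOrdinal_toZFSet o).isTransitive
    (by rwa [Ordinal.card_toZFSet])

/-- The set `ω₁`, as a von Neumann ordinal. -/
noncomputable def omegaOne : ZFSet.{u} :=
  (Ordinal.omega 1).toZFSet

theorem mk_omegaOne : #(omegaOne.{u} : Set ZFSet.{u}) = ℵ₁ := by
  rw [mk_coe]; simp [omegaOne]

theorem nonempty_of_mk_eq_aleph_one {X : Set ZFSet.{u}} (h : #X = ℵ₁) : X.Nonempty := by
  rw [← Set.nonempty_coe_sort, ← Cardinal.mk_ne_zero_iff, h]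
  exact (Cardinal.aleph_pos 1).ne'

theorem omegaOne_mem_H {χ : Cardinal.{u}} (h : ℵ₁ < χ) : omegaOne ∈ H χ :=
  toZFSet_mem_H (by simpa using h)

theorem aleph_one_le_mk_H {χ : Cardinal.{u}} (h : ℵ₁ < χ) : ℵ₁ ≤ #(H χ) :=
  mk_omegaOne.ge.trans (Cardinal.mk_le_mk_of_subset fun _ hx => mem_H_of_mem (omegaOne_mem_H h) hx)

/-- Every countable subset of `N` is included in a countable subset of `N` that is an element of
`N`. -/
def IsCountablyCovered (N : Set ZFSet.{u}) : Prop :=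
  ∀ Y ⊆ N, Y.Countable →
    ∃ y ∈ N, Y ⊆ (y : Set ZFSet.{u}) ∧ (y : Set ZFSet.{u}) ⊆ N ∧ (y : Set ZFSet.{u}).Countable

theorem cofinalIn_countableMembers_iff {M : Set ZFSet.{u}} (hM : #M = ℵ₁) :
    CofinalIn (countableMembers M) (subsetsOfCard M ℵ₀) ↔ IsCountablyCovered M := by
  constructor
  · intro hcof Y hYM hYc
    obtain ⟨Z, hZM, hZ⟩ := Cardinal.le_mk_iff_exists_subset.1
      ((Cardinal.aleph0_le_aleph 1).trans hM.ge)
    have hYZ : #(Y ∪ Z : Set ZFSet.{u}) = ℵ₀ := le_antisymm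
      (hYc.union (Cardinal.le_aleph0_iff_set_countable.1 hZ.le)).le_aleph0
      (hZ.ge.trans (Cardinal.mk_le_mk_of_subset Set.subset_union_right))
    obtain ⟨_, ⟨⟨hyM, hyc⟩, y, hy, rfl⟩, hYy⟩ := hcof _ ⟨Set.union_subset hYM hZM, hYZ⟩
    exact ⟨y, hy, Set.subset_union_left.trans hYy, hyM,
      Cardinal.le_aleph0_iff_set_countable.1 hyc.le⟩
  · rintro hcov Y ⟨hYM, hYc⟩
    obtain ⟨y, hy, hYy, hyM, hyc⟩ := hcov Y hYM (Cardinal.le_aleph0_iff_set_countable.1 hYc.le)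
    exact ⟨y, ⟨⟨hyM, le_antisymm hyc.le_aleph0
      (hYc.ge.trans (Cardinal.mk_le_mk_of_subset hYy))⟩, y, hy, rfl⟩, hYy⟩

theorem mk_union_le_aleph_one {α : Type*} {s t : Set α} (hs : #s ≤ ℵ₁) (ht : #t ≤ ℵ₁) :
    #(s ∪ t : Set α) ≤ ℵ₁ :=
  (Cardinal.mk_union_le s t).trans (Cardinal.add_le_of_le (Cardinal.aleph0_le_aleph 1) hs ht)

theorem mk_sUnion_le_aleph_one {α : Type*} {𝒟 : Set (Set α)} (h : #𝒟 ≤ ℵ₁)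
    (h' : ∀ s ∈ 𝒟, #s ≤ ℵ₁) : #(⋃₀ 𝒟) ≤ ℵ₁ :=
  calc #(⋃₀ 𝒟) ≤ #𝒟 * ⨆ s : 𝒟, #s := Cardinal.mk_sUnion_le 𝒟
    _ ≤ ℵ₁ * ℵ₁ := mul_le_mul' h (ciSup_le' fun s => h' s s.2)
    _ = ℵ₁ := Cardinal.mul_eq_self (Cardinal.aleph0_le_aleph 1)

theorem mk_le_aleph_one_of_countable {α : Type*} {s : Set α} (hs : s.Countable) : #s ≤ ℵ₁ :=
  hs.le_aleph0.trans (Cardinal.aleph0_le_aleph 1)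

theorem exists_subsetsOfCard {X Y : Set ZFSet.{u}} (hX : ℵ₁ ≤ #X) (hY : Y ⊆ X) (hc : #Y ≤ ℵ₁) :
    ∃ Z ∈ subsetsOfCard X ℵ₁, Y ⊆ Z := by
  obtain ⟨Z, hZX, hZ⟩ := Cardinal.le_mk_iff_exists_subset.1 hX
  exact ⟨Y ∪ Z, ⟨Set.union_subset hY hZX, le_antisymm (mk_union_le_aleph_one hc hZ.le)
    (hZ.ge.trans (Cardinal.mk_le_mk_of_subset Set.subset_union_right))⟩, Set.subset_union_left⟩

theorem exists_mapsTo_superset {X Z : Set ZFSet.{u}} (hZ : Z ∈ subsetsOfCard X ℵ₁)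
    {f : ZFSet.{u} → ZFSet.{u}} (hf : Set.MapsTo f X X) :
    ∃ N ∈ subsetsOfCard X ℵ₁, Z ⊆ N ∧ Set.MapsTo f N N := by
  let N : Set ZFSet.{u} := ⋃₀ Set.range fun n : ℕ => f^[n] '' Z
  have hZN : Z ⊆ N := fun z hz => ⟨_, ⟨0, rfl⟩, z, hz, rfl⟩
  have hNX : N ⊆ X := by
    rintro _ ⟨_, ⟨n, rfl⟩, z, hz, rfl⟩
    exact hf.iterate n (hZ.1 hz)
  have hNf : Set.MapsTo f N N := by
    rintro _ ⟨_, ⟨n, rfl⟩, z, hz, rfl⟩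
    exact ⟨_, ⟨n + 1, rfl⟩, z, hz, Function.iterate_succ_apply' f n z⟩
  have hNc : #N ≤ ℵ₁ := by
    refine mk_sUnion_le_aleph_one (mk_le_aleph_one_of_countable (Set.countable_range _)) ?_
    rintro _ ⟨n, rfl⟩
    exact Cardinal.mk_image_le.trans hZ.2.le
  exact ⟨N, ⟨hNX, le_antisymm hNc (hZ.2.ge.trans (Cardinal.mk_le_mk_of_subset hZN))⟩, hZN, hNf⟩

theorem isClub_mapsTo {X Y : Set ZFSet.{u}} (hX : ℵ₁ ≤ #X) (hY : Y ⊆ X) (hc : #Y ≤ ℵ₁)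
    {f : ZFSet.{u} → ZFSet.{u}} (hf : Set.MapsTo f X X) :
    IsClub X {N ∈ subsetsOfCard X ℵ₁ | Y ⊆ N ∧ Set.MapsTo f N N} := by
  refine ⟨fun N hN => hN.1, fun Z hZ => ?_, fun 𝒟 h𝒟 ⟨N, hN⟩ _ hcard => ?_⟩
  · obtain ⟨Z', hZ', hYZ⟩ := exists_subsetsOfCard hX (Set.union_subset hY hZ.1)
      (mk_union_le_aleph_one hc hZ.2.le)
    obtain ⟨N, hN, hZN, hNf⟩ := exists_mapsTo_superset hZ' hf
    have hYZN := hYZ.trans hZN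
    exact ⟨N, ⟨hN, Set.subset_union_left.trans hYZN, hNf⟩, Set.subset_union_right.trans hYZN⟩
  · have hNsub := Set.subset_sUnion_of_mem hN
    refine ⟨⟨Set.sUnion_subset fun S hS => (h𝒟 hS).1.1, le_antisymm ?_ ?_⟩,
      (h𝒟 hN).2.1.trans hNsub, ?_⟩
    · exact mk_sUnion_le_aleph_one hcard fun S hS => (h𝒟 hS).1.2.le
    · exact (h𝒟 hN).1.2.ge.trans (Cardinal.mk_le_mk_of_subset hNsub)
    · rintro a ⟨S, hS, ha⟩
      exact ⟨S, hS, (h𝒟 hS).2.2 ha⟩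

theorem exists_isChain_sUnion_eq {α : Type*} {𝒟 : Set (Set α)}
    (hdir : ∀ 𝒟' ⊆ 𝒟, 𝒟'.Countable → ∃ d ∈ 𝒟, ⋃₀ 𝒟' ⊆ d) (hc : #(⋃₀ 𝒟) ≤ ℵ₁) :
    ∃ 𝒟' ⊆ 𝒟, IsChain (· ⊆ ·) 𝒟' ∧ #𝒟' ≤ ℵ₁ ∧ ⋃₀ 𝒟' = ⋃₀ 𝒟 := by
  obtain ⟨r, hr, hro⟩ := Cardinal.exists_ord_eq (⋃₀ 𝒟)
  have hseg : ∀ x : ⋃₀ 𝒟, {y | r y x}.Countable := fun x => by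
    rw [← Cardinal.le_aleph0_iff_set_countable, ← Order.lt_succ_iff, Cardinal.succ_aleph0]
    exact (Cardinal.card_typein_lt (r := r) x hro).trans_le hc
  have hstep : ∀ (x : ⋃₀ 𝒟) (e : ∀ y, r y x → 𝒟),
      ∃ d : 𝒟, x.1 ∈ d.1 ∧ ∀ y (h : r y x), (e y h).1 ⊆ d := fun x e => by
    obtain ⟨d₀, hd₀, hx⟩ := x.2
    have := (hseg x).to_subtype
    obtain ⟨d, hd, hsub⟩ := hdir (insert d₀ (Set.range fun y : {y | r y x} => (e y.1 y.2).1))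
      (Set.insert_subset hd₀ (Set.range_subset_iff.2 fun y => (e y.1 y.2).2))
      ((Set.countable_range _).insert _)
    exact ⟨⟨d, hd⟩, hsub ⟨d₀, Or.inl rfl, hx⟩, fun y h =>
      (Set.subset_sUnion_of_mem (Or.inr ⟨⟨y, h⟩, rfl⟩)).trans hsub⟩
  choose next hmem hnext using hstep
  let d : ⋃₀ 𝒟 → 𝒟 := hr.wf.fix next
  have hd : ∀ x, d x = next x fun y _ => d y := hr.wf.fix_eq next
  have hdmem : ∀ x, x.1 ∈ (d x).1 := fun x => by
    rw [hd x]
    exact hmem x _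
  have hlt : ∀ x y, r y x → (d y).1 ⊆ d x := fun x y h => by
    rw [hd x]
    exact hnext x (fun y _ => d y) y h
  refine ⟨Set.range fun x => (d x).1, Set.range_subset_iff.2 fun x => (d x).2, ?_,
    Cardinal.mk_range_le.trans hc, Set.Subset.antisymm ?_ fun x hx => ?_⟩
  · rintro _ ⟨x, rfl⟩ _ ⟨y, rfl⟩ _
    rcases trichotomous_of r x y with h | rfl | h
    exacts [Or.inl (hlt _ _ h), Or.inl subset_rfl, Or.inr (hlt _ _ h)]
  · exact Set.sUnion_subset_sUnion (Set.range_subset_iff.2 fun x => (d x).2)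
  · exact ⟨_, ⟨⟨x, hx⟩, rfl⟩, hdmem ⟨x, hx⟩⟩

theorem IsClub.sUnion_mem_of_sigmaDirected {X : Set ZFSet.{u}} {𝒞 : Set (Set ZFSet.{u})}
    (h𝒞 : IsClub X 𝒞) {𝒟 : Set (Set ZFSet.{u})} (h𝒟 : 𝒟 ⊆ 𝒞)
    (hdir : ∀ 𝒟' ⊆ 𝒟, 𝒟'.Countable → ∃ d ∈ 𝒟, ⋃₀ 𝒟' ⊆ d) (hc : #(⋃₀ 𝒟) = ℵ₁) :
    ⋃₀ 𝒟 ∈ 𝒞 := by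
  obtain ⟨𝒟', h𝒟', hchain, hcard, hunion⟩ := exists_isChain_sUnion_eq hdir hc.le
  have hne : 𝒟'.Nonempty := by
    refine Set.nonempty_iff_ne_empty.2 fun h => (Cardinal.aleph_pos 1).ne ?_
    rw [← hc, ← hunion, h, Set.sUnion_empty, Cardinal.mk_eq_zero]
  exact hunion ▸ h𝒞.2.2 𝒟' (h𝒟'.trans h𝒟) hne hchain hcard

theorem IsElementarySubmodel.subset {M X : Set ZFSet.{u}} (h : IsElementarySubmodel M X) :
    M ⊆ X := by
  obtain ⟨S, rfl⟩ := h
  rintro _ ⟨x, _, rfl⟩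
  exact x.2

theorem card_langSet_le : langSet.card ≤ ℵ₀ := by
  have hrel : Countable (Σ n, MemRel n) :=
    Function.Injective.countable (f := fun _ => ()) (by rintro ⟨_, ⟨⟩⟩ ⟨_, ⟨⟩⟩ _; rfl)
  exact Cardinal.mk_le_aleph0_iff.2
    (inferInstanceAs (Countable ((Σ _ : ℕ, Empty) ⊕ (Σ n, MemRel n))))

theorem exists_countable_isElementarySubmodel {X A : Set ZFSet.{u}} (hX : ℵ₀ ≤ #X) (hA : A ⊆ X)
    (hc : A.Countable) : ∃ V, (IsElementarySubmodel V X ∧ V.Countable) ∧ A ⊆ V := by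
  obtain ⟨S, hAS, hS⟩ := FirstOrder.Language.exists_elementarySubstructure_card_eq langSet
    (Subtype.val ⁻¹' A : Set X) (ℵ₀ : Cardinal.{0}) le_rfl
    (by simpa using (hc.preimage Subtype.val_injective).le_aleph0)
    (by simpa using card_langSet_le) (by simpa using hX)
  refine ⟨_, ⟨⟨S, rfl⟩, Set.Countable.image ?_ _⟩, fun x hx => ⟨⟨x, hA hx⟩, hAS hx, rfl⟩⟩
  rw [← Cardinal.le_aleph0_iff_set_countable]
  simpa using hS.le

theorem isElementarySubmodel_iUnion {X : Set ZFSet.{u}} {ι : Type*} [Nonempty ι]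
    {V : ι → Set ZFSet.{u}} (hV : ∀ i, IsElementarySubmodel (V i) X)
    (hdir : Directed (· ⊆ ·) V) : IsElementarySubmodel (⋃ i, V i) X := by
  let T : langSet.Substructure X :=
    { carrier := {x | (x : ZFSet.{u}) ∈ ⋃ i, V i}
      fun_mem := fun f => nomatch f }
  have hT : T.IsElementary := by
    refine T.isElementary_of_exists fun n φ x a h => ?_
    choose f hf using fun j => Set.mem_iUnion.1 (x j).2
    obtain ⟨i, hi⟩ := hdir.finite_le f
    obtain ⟨S, hS⟩ := hV i
    have hxS : ∀ j, (x j : X) ∈ S := fun j =>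
      (Subtype.val_injective.mem_set_image).1 (hS ▸ hi j (hf j))
    let y : Fin n → S := fun j => ⟨x j, hxS j⟩
    have hdef : (S.subtype ∘ default : Empty → X) = default := Subsingleton.elim _ _
    have hex : φ.ex.Realize (default : Empty → S) y := by
      rw [← S.subtype.map_boundedFormula, FirstOrder.Language.BoundedFormula.realize_ex, hdef]
      exact ⟨a, h⟩
    obtain ⟨b, hb⟩ := FirstOrder.Language.BoundedFormula.realize_ex.1 hex
    rw [← S.subtype.map_boundedFormula, hdef, Fin.comp_snoc] at hb
    exact ⟨⟨b, Set.mem_iUnion.2 ⟨i, hS.ge ⟨b, b.2, rfl⟩⟩⟩, hb⟩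
  refine ⟨⟨T, hT⟩, Set.Subset.antisymm (fun x hx => ?_) (by rintro _ ⟨y, hy, rfl⟩; exact hy)⟩
  obtain ⟨i, hi⟩ := Set.mem_iUnion.1 hx
  exact ⟨⟨x, (hV i).subset hi⟩, hx, rfl⟩

theorem rank_lt_rank_pair_left (a b : ZFSet.{u}) : rank a < rank (pair a b) :=
  (rank_lt_of_mem (y := a) (x := {a}) (by simp)).trans (rank_lt_of_mem (by simp [pair]))

theorem rank_lt_rank_pair_right (a b : ZFSet.{u}) : rank b < rank (pair a b) :=
  (rank_lt_of_mem (y := b) (x := {a, b}) (by simp)).trans (rank_lt_of_mem (by simp [pair]))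

theorem exists_forall_seed_subset {Q : Set ZFSet.{u} → Prop} (hQ : ∃ N, Q N)
    (seed : ZFSet.{u} → (ZFSet.{u} → Set ZFSet.{u}) → Set ZFSet.{u})
    (hlocal : ∀ d U U', (∀ y, rank y < rank d → U y = U' y) → seed d U = seed d U')
    (hseed : ∀ d U, (∀ y, Q (U y)) → ∃ N, Q N ∧ seed d U ⊆ N) :
    ∃ V : ZFSet.{u} → Set ZFSet.{u}, (∀ d, Q (V d)) ∧ ∀ d, seed d V ⊆ V d := by
  classical
  obtain ⟨N₀, hN₀⟩ := hQ
  have hwf : WellFounded fun y d : ZFSet.{u} => rank y < rank d := InvImage.wf rank wellFounded_lt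
  let extend (d : ZFSet.{u}) (e : ∀ y, rank y < rank d → {N // Q N}) (y : ZFSet.{u}) : {N // Q N} :=
    if h : rank y < rank d then e y h else ⟨N₀, hN₀⟩
  choose next hQnext hnext using fun d (e : ∀ y, rank y < rank d → {N // Q N}) =>
    hseed d (fun y => extend d e y) fun y => (extend d e y).2
  let step (d : ZFSet.{u}) (e : ∀ y, rank y < rank d → {N // Q N}) : {N // Q N} :=
    ⟨next d e, hQnext d e⟩
  let V : ZFSet.{u} → {N // Q N} := hwf.fix step
  have hV : ∀ d, (V d).1 = next d fun y _ => V y := fun d =>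
    congrArg Subtype.val (hwf.fix_eq step d)
  refine ⟨fun d => V d, fun d => (V d).2, fun d => ?_⟩
  change seed d (fun y => V y) ⊆ (V d).1
  rw [hV d, hlocal d _ (fun y => extend d (fun y _ => V y) y) fun y hy => by simp [extend, hy]]
  exact hnext d _

theorem IsClub.exists_assignment {X : Set ZFSet.{u}} (hX : ℵ₁ ≤ #X) {𝒞 : Set (Set ZFSet.{u})}
    (h𝒞 : IsClub X 𝒞) :
    ∃ C : ZFSet.{u} → Set ZFSet.{u}, (∀ s, C s ∈ 𝒞) ∧
      ∀ s : ZFSet.{u}, (s : Set ZFSet.{u}).Countable → (s : Set ZFSet.{u}) ⊆ X →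
        (s : Set ZFSet.{u}) ⊆ C s ∧ ∀ t ∈ s, C t ⊆ C s := by
  have hcofinal : ∀ Y ⊆ X, #Y ≤ ℵ₁ → ∃ N ∈ 𝒞, Y ⊆ N := fun Y hY hc => by
    obtain ⟨Z, hZ, hYZ⟩ := exists_subsetsOfCard hX hY hc
    obtain ⟨N, hN, hZN⟩ := h𝒞.2.1 Z hZ
    exact ⟨N, hN, hYZ.trans hZN⟩
  have hempty : ∃ N ∈ 𝒞, ∅ ⊆ N := hcofinal ∅ (Set.empty_subset X) (by simp)
  obtain ⟨C, hC𝒞, hC⟩ := exists_forall_seed_subset (Q := (· ∈ 𝒞)) (hempty.imp fun _ => And.left)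
    (fun s U => {x | ((s : Set ZFSet.{u}).Countable ∧ (s : Set ZFSet.{u}) ⊆ X) ∧
      (x ∈ s ∨ ∃ t ∈ s, x ∈ U t)})
    (fun s U U' h => Set.ext fun x => and_congr_right fun _ => or_congr_right <|
      exists_congr fun t => and_congr_right fun ht => by rw [h t (rank_lt_of_mem ht)])
    fun s U hU => by
      by_cases hs : (s : Set ZFSet.{u}).Countable ∧ (s : Set ZFSet.{u}) ⊆ X
      · obtain ⟨N, hN, hsub⟩ := hcofinal (s ∪ ⋃₀ (U '' s))
          (Set.union_subset hs.2
            (Set.sUnion_subset (by rintro _ ⟨t, _, rfl⟩; exact (h𝒞.1 (hU t)).1)))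
          (mk_union_le_aleph_one (mk_le_aleph_one_of_countable hs.1) (mk_sUnion_le_aleph_one
            (mk_le_aleph_one_of_countable (hs.1.image U))
            (by rintro _ ⟨t, _, rfl⟩; exact (h𝒞.1 (hU t)).2.le)))
        refine ⟨N, hN, ?_⟩
        rintro x ⟨-, hx | ⟨t, ht, hx⟩⟩
        exacts [hsub (Or.inl hx), hsub (Or.inr ⟨_, ⟨t, ht, rfl⟩, hx⟩)]
      · obtain ⟨N, hN, -⟩ := hempty
        exact ⟨N, hN, fun x hx => absurd hx.1 hs⟩
  exact ⟨C, hC𝒞, fun s hsc hsX => ⟨fun x hx => hC s ⟨⟨hsc, hsX⟩, Or.inl hx⟩,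
    fun t ht x hx => hC s ⟨⟨hsc, hsX⟩, Or.inr ⟨t, ht, hx⟩⟩⟩⟩

theorem IsClub.mem_of_isCountablyCovered {X : Set ZFSet.{u}} {𝒞 : Set (Set ZFSet.{u})}
    (h𝒞 : IsClub X 𝒞) {C : ZFSet.{u} → Set ZFSet.{u}} (hC : ∀ s, C s ∈ 𝒞)
    (hCmono : ∀ s : ZFSet.{u}, (s : Set ZFSet.{u}).Countable → (s : Set ZFSet.{u}) ⊆ X →
      (s : Set ZFSet.{u}) ⊆ C s ∧ ∀ t ∈ s, C t ⊆ C s)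
    {M : Set ZFSet.{u}} (hM : M ∈ subsetsOfCard X ℵ₁) (hcov : IsCountablyCovered M)
    (hCM : ∀ s ∈ M, C s ⊆ M) : M ∈ 𝒞 := by
  have hunion : ⋃₀ (C '' M) = M := by
    refine Set.Subset.antisymm (Set.sUnion_subset (by rintro _ ⟨s, hs, rfl⟩; exact hCM s hs)) ?_
    intro x hx
    obtain ⟨y, hy, hxy, hyM, hyc⟩ := hcov {x} (Set.singleton_subset_iff.2 hx)
      (Set.countable_singleton x)
    exact ⟨_, ⟨y, hy, rfl⟩, (hCmono y hyc (hyM.trans hM.1)).1 (hxy rfl)⟩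
  rw [← hunion]
  refine h𝒞.sUnion_mem_of_sigmaDirected (by rintro _ ⟨s, _, rfl⟩; exact hC s) (fun 𝒟 h𝒟 h𝒟c => ?_)
    (by rw [hunion, hM.2])
  obtain ⟨S₀, hS₀M, rfl⟩ := Set.subset_image_iff.1 h𝒟
  obtain ⟨S, hSS₀, hbij⟩ := S₀.exists_subset_bijOn C
  rw [← hbij.image_eq] at h𝒟c ⊢
  obtain ⟨y, hy, hSy, hyM, hyc⟩ := hcov S (hSS₀.trans hS₀M)
    (Set.countable_of_injective_of_countable_image hbij.injOn h𝒟c)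
  refine ⟨_, ⟨y, hy, rfl⟩, Set.sUnion_subset ?_⟩
  rintro _ ⟨s, hs, rfl⟩
  exact (hCmono y hyc (hyM.trans hM.1)).2 s (hSy hs)

/-- Countable elementary submodels `V d` of `H_χ`, one for every set `d`, which contain the
parameter `p`, increase along pairing, absorb the function `E h` from sets to elements of `H_χ` for
each `h`, and see the union `⋃ b ∈ d, V b` for every countable `d`. -/
structure IsHullSystem (χ : Cardinal.{u}) (p : ZFSet.{u}) (E : ZFSet.{u} → ZFSet.{u} → ZFSet.{u})
    (V : ZFSet.{u} → Set ZFSet.{u}) : Prop where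
  isElementarySubmodel (d : ZFSet.{u}) : IsElementarySubmodel (V d) (H χ)
  countable (d : ZFSet.{u}) : (V d).Countable
  param_mem (d : ZFSet.{u}) : p ∈ V d
  self_mem {d : ZFSet.{u}} (hd : d ∈ H χ) : d ∈ V d
  union_subset_pair (a b : ZFSet.{u}) : V a ∪ V b ⊆ V (pair a b)
  map_mem_pair (a b : ZFSet.{u}) {h : ZFSet.{u}} (hh : h ∈ V b) : E h a ∈ V (pair a b)
  exists_biUnion_mem {d : ZFSet.{u}} (hd : (d : Set ZFSet.{u}).Countable) :
    ∃ z ∈ V d, (z : Set ZFSet.{u}) = ⋃ b ∈ (d : Set ZFSet.{u}), V b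

/-- The set generating the submodel `V d` of a hull system, in terms of the submodels `U y` with `y`
of smaller rank than `d`. -/
def hullSeed (χ : Cardinal.{u}) (p : ZFSet.{u}) (E : ZFSet.{u} → ZFSet.{u} → ZFSet.{u})
    (d : ZFSet.{u}) (U : ZFSet.{u} → Set ZFSet.{u}) : Set ZFSet.{u} :=
  ({p} ∪ {x | x = d ∧ d ∈ H χ}) ∪
    ((⋃ q ∈ {q : ZFSet.{u} × ZFSet.{u} | d = pair q.1 q.2},
      (U q.1 ∪ U q.2 ∪ (fun h => E h q.1) '' U q.2)) ∪
    {z | (d : Set ZFSet.{u}).Countable ∧ (z : Set ZFSet.{u}) = ⋃ b ∈ (d : Set ZFSet.{u}), U b})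

section hullSeed

variable {χ : Cardinal.{u}} {p d : ZFSet.{u}} {E : ZFSet.{u} → ZFSet.{u} → ZFSet.{u}}
  {U U' : ZFSet.{u} → Set ZFSet.{u}}

theorem hullSeed_congr (h : ∀ y, rank y < rank d → U y = U' y) :
    hullSeed χ p E d U = hullSeed χ p E d U' := by
  have hpair : ∀ q ∈ {q : ZFSet.{u} × ZFSet.{u} | d = pair q.1 q.2},
      U q.1 = U' q.1 ∧ U q.2 = U' q.2 := by
    rintro q rfl
    exact ⟨h _ (rank_lt_rank_pair_left _ _), h _ (rank_lt_rank_pair_right _ _)⟩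
  have hmem : ⋃ b ∈ (d : Set ZFSet.{u}), U b = ⋃ b ∈ (d : Set ZFSet.{u}), U' b :=
    Set.iUnion₂_congr fun b hb => h b (rank_lt_of_mem hb)
  rw [hullSeed, hullSeed, hmem,
    Set.iUnion₂_congr fun q hq => by rw [(hpair q hq).1, (hpair q hq).2]]

theorem hullSeed_countable (hU : ∀ y, (U y).Countable) : (hullSeed χ p E d U).Countable := by
  refine ((Set.countable_singleton p).union (Set.Subsingleton.countable ?_)).union
    ((Set.Countable.biUnion (Set.Subsingleton.countable ?_) fun q _ =>
      ((hU _).union (hU _)).union ((hU _).image _)).union (Set.Subsingleton.countable ?_))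
  · rintro x ⟨rfl, -⟩ y ⟨rfl, -⟩
    rfl
  · rintro ⟨a, b⟩ hq ⟨a', b'⟩ hq'
    obtain ⟨rfl, rfl⟩ := pair_injective ((Eq.symm hq).trans hq')
    rfl
  · rintro z ⟨-, hz⟩ z' ⟨-, hz'⟩
    exact SetLike.coe_injective (hz.trans hz'.symm)

theorem hullSeed_subset_H (hχ : χ.IsRegular) (h0 : ℵ₀ < χ) (hp : p ∈ H χ)
    (hE : ∀ h ∈ H χ, ∀ a, E h a ∈ H χ) (hUH : ∀ y, U y ⊆ H χ) (hUc : ∀ y, (U y).Countable) :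
    hullSeed χ p E d U ⊆ H χ := by
  refine Set.union_subset ?_ (Set.union_subset (Set.iUnion₂_subset fun q _ => ?_) ?_)
  · rintro x (rfl | ⟨rfl, hx⟩) <;> assumption
  · refine Set.union_subset (Set.union_subset (hUH _) (hUH _)) ?_
    rintro _ ⟨h, hh, rfl⟩
    exact hE h (hUH _ hh) _
  · rintro z ⟨hd, hz⟩
    refine isCountablyClosed_H hχ h0 z ?_ ?_ <;> rw [hz]
    exacts [Set.iUnion₂_subset fun b _ => hUH b, hd.biUnion fun b _ => hUc b]

theorem exists_isHullSystem (hχ : χ.IsRegular) (h1 : ℵ₁ < χ) (hp : p ∈ H χ)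
    (hE : ∀ h ∈ H χ, ∀ a, E h a ∈ H χ) : ∃ V, IsHullSystem χ p E V := by
  have h0 : ℵ₀ < χ := aleph0_lt_aleph_one.trans h1
  have hH : ℵ₀ ≤ #(H χ) := (Cardinal.aleph0_le_aleph 1).trans (aleph_one_le_mk_H h1)
  obtain ⟨V, hV, hsub⟩ := exists_forall_seed_subset
    ((exists_countable_isElementarySubmodel hH (Set.empty_subset _) Set.countable_empty).imp
      fun _ => And.left)
    (hullSeed χ p E) (fun _ _ _ => hullSeed_congr) fun d U hU =>
      exists_countable_isElementarySubmodel hH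
        (hullSeed_subset_H hχ h0 hp hE (fun y => (hU y).1.subset) fun y => (hU y).2)
        (hullSeed_countable fun y => (hU y).2)
  have hpair : ∀ a b, V a ∪ V b ∪ (fun h => E h a) '' V b ⊆ V (pair a b) := fun a b x hx =>
    hsub _ (Or.inr (Or.inl (Set.mem_iUnion₂.2 ⟨(a, b), rfl, hx⟩)))
  refine ⟨V, fun d => (hV d).1, fun d => (hV d).2, fun d => hsub d (Or.inl (Or.inl rfl)),
    fun hd => hsub _ (Or.inl (Or.inr ⟨rfl, hd⟩)),
    fun a b => Set.subset_union_left.trans (hpair a b),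
    fun a b h hh => hpair a b (Or.inr ⟨h, hh, rfl⟩), fun {d} hd => ?_⟩
  have := (hd.biUnion fun b _ => (hV b).2).to_subtype
  obtain ⟨z, hz⟩ := exists_coe_eq (⋃ b ∈ (d : Set ZFSet.{u}), V b)
  exact ⟨z, hsub d (Or.inr (Or.inr ⟨hd, hz⟩)), hz⟩

end hullSeed

namespace IsHullSystem

variable {χ : Cardinal.{u}} {p : ZFSet.{u}} {E : ZFSet.{u} → ZFSet.{u} → ZFSet.{u}}
  {V : ZFSet.{u} → Set ZFSet.{u}} (hV : IsHullSystem χ p E V) {N : Set ZFSet.{u}}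
include hV

theorem isElementarySubmodel_biUnion (hN : N.Nonempty) (hpair : ∀ a ∈ N, ∀ b ∈ N, pair a b ∈ N) :
    IsElementarySubmodel (⋃ d ∈ N, V d) (H χ) := by
  have := hN.to_subtype
  rw [Set.biUnion_eq_iUnion]
  exact isElementarySubmodel_iUnion (fun d => hV.isElementarySubmodel d) fun a b =>
    ⟨⟨_, hpair a a.2 b b.2⟩, Set.union_subset_iff.1 (hV.union_subset_pair a b)⟩

theorem mk_biUnion (h1 : ℵ₁ < χ) (hN : #N ≤ ℵ₁) (hω : (omegaOne : Set ZFSet.{u}) ⊆ N) :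
    #(⋃ d ∈ N, V d : Set ZFSet.{u}) = ℵ₁ := by
  refine le_antisymm ?_ (mk_omegaOne.ge.trans (Cardinal.mk_le_mk_of_subset fun x hx =>
    Set.mem_biUnion (hω hx) (hV.self_mem (mem_H_of_mem (omegaOne_mem_H h1) hx))))
  rw [← Set.sUnion_image]
  refine mk_sUnion_le_aleph_one (Cardinal.mk_image_le.trans hN) ?_
  rintro _ ⟨d, _, rfl⟩
  exact mk_le_aleph_one_of_countable (hV.countable d)

theorem isCountablyCovered_biUnion (hN : IsCountablyCovered N) :
    IsCountablyCovered (⋃ d ∈ N, V d) := by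
  intro Y hY hYc
  choose d hdN hd using fun x : Y => Set.mem_iUnion₂.1 (hY x.2)
  have := hYc.to_subtype
  obtain ⟨s, hsN, hds, hsub, hsc⟩ := hN (Set.range d) (Set.range_subset_iff.2 hdN)
    (Set.countable_range d)
  obtain ⟨z, hz, hz'⟩ := hV.exists_biUnion_mem hsc
  refine ⟨z, Set.mem_biUnion hsN hz, ?_⟩
  rw [hz']
  exact ⟨fun x hx => Set.mem_biUnion (hds ⟨⟨x, hx⟩, rfl⟩) (hd ⟨x, hx⟩),
    Set.biUnion_subset_biUnion_left hsub, hsc.biUnion fun b _ => hV.countable b⟩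

end IsHullSystem

theorem exists_surjOn_omegaOne {Y : Set ZFSet.{u}} (hne : Y.Nonempty) (hY : #Y ≤ ℵ₁) :
    ∃ e : ZFSet.{u} → ZFSet.{u}, (∀ a, e a ∈ Y) ∧ Set.SurjOn e omegaOne Y := by
  have := hne.to_subtype
  obtain ⟨g⟩ := Cardinal.le_def _ _ |>.1 (hY.trans mk_omegaOne.ge)
  let e : ZFSet.{u} → Y := Function.invFun fun y => (g y).1
  have he : Function.LeftInverse e fun y => (g y).1 :=
    Function.leftInverse_invFun (Subtype.val_injective.comp g.injective)
  exact ⟨fun a => e a, fun a => (e a).2, fun y hy =>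
    ⟨g ⟨y, hy⟩, (g _).2, congrArg Subtype.val (he ⟨y, hy⟩)⟩⟩

namespace SetPoset

variable (P : SetPoset.{u})

/-- `N` is a subset of `D` of cardinality at most `ℵ₁` which includes `ω₁`, is closed under pairing
and under a choice of `R`-images, is covered by its countable elements, and satisfies
`P ∩ N ≤_σ P`. -/
structure IsReflecting (D : Set ZFSet.{u}) (R : ZFSet.{u} → ZFSet.{u} → Prop)
    (N : Set ZFSet.{u}) : Prop where
  subset : N ⊆ D
  mk_le : #N ≤ ℵ₁
  omegaOne_subset : (omegaOne : Set ZFSet.{u}) ⊆ N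
  pair_mem : ∀ a ∈ N, ∀ b ∈ N, pair a b ∈ N
  exists_rel : ∀ a ∈ N, ∃ b ∈ N, R a b
  isCountablyCovered : IsCountablyCovered N
  leSigma : P.LeSigma ((P.carrier : Set ZFSet.{u}) ∩ N)

/-- Every relation that is total on `D` has a reflecting subset. Unlike the elementarity of a
submodel of `H_χ`, this does not mention `χ`, so it transfers between different `χ`. -/
def HasReflection (D : Set ZFSet.{u}) : Prop :=
  ∀ R : ZFSet.{u} → ZFSet.{u} → Prop, (∀ a ∈ D, ∃ b ∈ D, R a b) → ∃ N, P.IsReflecting D R N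

variable {P} {χ : Cardinal.{u}}

theorem aleph_one_lt_of_kappa_lt (h : P.kappa < χ) : ℵ₁ < χ :=
  (le_max_right _ _).trans_lt h

theorem carrier_mem_H (h : P.kappa < χ) : P.carrier ∈ H χ :=
  (le_max_left _ _).trans_lt h

theorem code_mem_H (hχ : χ.IsRegular) (h : P.kappa < χ) : P.code ∈ H χ := by
  have h0 : ℵ₀ < χ := aleph0_lt_aleph_one.trans (aleph_one_lt_of_kappa_lt h)
  have hc := carrier_mem_H h
  exact (isCountablyClosed_H hχ h0).pair_mem hc
    (mem_H_of_subset (prod_mem_H hχ h0 hc hc) P.rel_subset)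

theorem models_subset (χ : Cardinal.{u}) : P.models χ ⊆ subsetsOfCard (H χ) ℵ₁ :=
  fun _ hM => ⟨hM.1.1.subset, hM.1.2.1⟩

theorem IsReflecting.biUnion_mem_models {E : ZFSet.{u} → ZFSet.{u} → ZFSet.{u}}
    {V : ZFSet.{u} → Set ZFSet.{u}} (hV : IsHullSystem χ P.code E V) (h1 : ℵ₁ < χ)
    {D : Set ZFSet.{u}} {R : ZFSet.{u} → ZFSet.{u} → Prop} {N : Set ZFSet.{u}}
    (hN : P.IsReflecting D R N)
    (hinter : (P.carrier : Set ZFSet.{u}) ∩ ⋃ d ∈ N, V d = (P.carrier : Set ZFSet.{u}) ∩ N) :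
    ⋃ d ∈ N, V d ∈ P.models χ := by
  obtain ⟨w, hw⟩ := (nonempty_of_mk_eq_aleph_one mk_omegaOne).mono hN.omegaOne_subset
  have hcard := hV.mk_biUnion h1 hN.mk_le hN.omegaOne_subset
  exact ⟨⟨hV.isElementarySubmodel_biUnion ⟨w, hw⟩ hN.pair_mem, hcard,
    (cofinalIn_countableMembers_iff hcard).2 (hV.isCountablyCovered_biUnion hN.isCountablyCovered)⟩,
    Set.mem_biUnion hw (hV.param_mem w), hinter ▸ hN.leSigma⟩

theorem HasReflection.exists_isReflecting_inter_eq {D : Set ZFSet.{u}} (hD : P.HasReflection D)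
    (hcD : (P.carrier : Set ZFSet.{u}) ⊆ D) {V : ZFSet.{u} → Set ZFSet.{u}}
    (hne : ∀ d, (V d).Nonempty) (hc : ∀ d, (V d).Countable) (hself : ∀ p ∈ P.carrier, p ∈ V p) :
    ∃ R N, P.IsReflecting D R N ∧
      (P.carrier : Set ZFSet.{u}) ∩ ⋃ d ∈ N, V d = (P.carrier : Set ZFSet.{u}) ∩ N := by
  choose en _ hen using fun d =>
    exists_surjOn_omegaOne (hne d) (mk_le_aleph_one_of_countable (hc d))
  let R (x y : ZFSet.{u}) : Prop := ∀ a d, x = pair a d → en d a ∈ P.carrier → y = en d a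
  have htotal : ∀ x ∈ D, ∃ y ∈ D, R x y := by
    intro x hx
    by_cases h : ∃ a d, x = pair a d ∧ en d a ∈ P.carrier
    · obtain ⟨a, d, rfl, had⟩ := h
      refine ⟨en d a, hcD had, fun a' d' h' _ => ?_⟩
      obtain ⟨rfl, rfl⟩ := pair_injective h'
      rfl
    · exact ⟨x, hx, fun a d hxad had => absurd ⟨a, d, hxad, had⟩ h⟩
  obtain ⟨N, hN⟩ := hD R htotal
  refine ⟨R, N, hN, Set.ext fun x => and_congr_right fun hx => ⟨fun hxV => ?_, fun hxN =>
    Set.mem_biUnion hxN (hself x hx)⟩⟩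
  obtain ⟨d, hd, hxd⟩ := Set.mem_iUnion₂.1 hxV
  obtain ⟨a, ha, rfl⟩ := hen d hxd
  obtain ⟨y, hy, hRy⟩ := hN.exists_rel _ (hN.pair_mem a (hN.omegaOne_subset ha) d hd)
  exact hRy a d rfl hx ▸ hy

theorem HasReflection.isStationary {D : Set ZFSet.{u}} (hD : P.HasReflection D)
    (hcD : (P.carrier : Set ZFSet.{u}) ⊆ D) (hχ : χ.IsRegular) (hκ : P.kappa < χ) :
    IsStationary (H χ) (P.models χ) := by
  refine ⟨models_subset χ, fun 𝒞 h𝒞 => ?_⟩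
  have h1 : ℵ₁ < χ := aleph_one_lt_of_kappa_lt hκ
  obtain ⟨C, hC𝒞, hCmono⟩ := h𝒞.exists_assignment (aleph_one_le_mk_H h1)
  have hCcard : ∀ s, #(C s) = ℵ₁ := fun s => (h𝒞.1 (hC𝒞 s)).2
  choose E hEC hE using fun s =>
    exists_surjOn_omegaOne (nonempty_of_mk_eq_aleph_one (hCcard s)) (hCcard s).le
  obtain ⟨V, hV⟩ := exists_isHullSystem hχ h1 (code_mem_H hχ hκ)
    fun s _ a => (h𝒞.1 (hC𝒞 s)).1 (hEC s a)
  obtain ⟨R, N, hN, hinter⟩ := hD.exists_isReflecting_inter_eq hcD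
    (fun d => ⟨_, hV.param_mem d⟩) hV.countable
    fun p hp => hV.self_mem (mem_H_of_mem (carrier_mem_H hκ) hp)
  have hM := hN.biUnion_mem_models hV h1 hinter
  refine ⟨_, hM, h𝒞.mem_of_isCountablyCovered hC𝒞 hCmono (models_subset χ hM)
    (hV.isCountablyCovered_biUnion hN.isCountablyCovered) fun s hs x hx => ?_⟩
  obtain ⟨d, hd, hsd⟩ := Set.mem_iUnion₂.1 hs
  obtain ⟨a, ha, rfl⟩ := hE s hx
  exact Set.mem_biUnion (hN.pair_mem a (hN.omegaOne_subset ha) d hd) (hV.map_mem_pair a d hsd)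

end SetPoset

/-- The relation `R` on the structure `(X, ∈)` is first-order definable with parameters from `A`. -/
def IsDefinable {X : Set ZFSet.{u}} (A : Set ZFSet.{u}) {α : Type} (R : (α → X) → Prop) : Prop :=
  (Subtype.val ⁻¹' A : Set X).Definable langSet {v | R v}

/-- The operation `t` takes values in `X` and its graph is definable in `(X, ∈)` with parameters
from `A`. The value is stored in the variable `Sum.inr ()`. -/
def IsDefinableFun {X : Set ZFSet.{u}} (A : Set ZFSet.{u}) {α : Type} (t : (α → X) → ZFSet.{u}) :
    Prop :=
  (∀ v, t v ∈ X) ∧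
    IsDefinable A fun w : α ⊕ Unit → X => (w (Sum.inr ()) : ZFSet.{u}) = t (w ∘ Sum.inl)

section

variable {X A : Set ZFSet.{u}} {α β : Type}

namespace IsDefinable

variable {R T : (α → X) → Prop}

theorem and (hR : IsDefinable A R) (hT : IsDefinable A T) : IsDefinable A fun v => R v ∧ T v :=
  hR.inter hT

theorem not (hR : IsDefinable A R) : IsDefinable A fun v => ¬R v :=
  hR.compl

theorem imp (hR : IsDefinable A R) (hT : IsDefinable A T) : IsDefinable A fun v => R v → T v := by
  simpa only [not_and, not_not] using (hR.and hT.not).not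

theorem iff (hR : IsDefinable A R) (hT : IsDefinable A T) : IsDefinable A fun v => (R v ↔ T v) := by
  simpa only [iff_iff_implies_and_implies] using (hR.imp hT).and (hT.imp hR)

theorem comp (hR : IsDefinable A R) (f : α → β) : IsDefinable A fun v : β → X => R (v ∘ f) :=
  hR.preimage_comp f

theorem ex {R : (α → X) → ZFSet.{u} → Prop}
    (hR : IsDefinable A fun w : α ⊕ Unit → X => R (w ∘ Sum.inl) (w (Sum.inr ()))) :
    IsDefinable A fun v => ∃ x ∈ X, R v x := by
  refine (congrArg _ (Set.ext fun v => ?_)).mp (Set.Definable.exists_of_finite hR)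
  exact ⟨fun ⟨u, hu⟩ => ⟨u (), (u ()).2, hu⟩, fun ⟨x, hx, h⟩ => ⟨fun _ => ⟨x, hx⟩, h⟩⟩

theorem all {R : (α → X) → ZFSet.{u} → Prop}
    (hR : IsDefinable A fun w : α ⊕ Unit → X => R (w ∘ Sum.inl) (w (Sum.inr ()))) :
    IsDefinable A fun v => ∀ x ∈ X, R v x := by
  simpa only [not_exists, not_and, not_not] using (ex (R := fun v x => ¬R v x) hR.not).not

theorem subst {R : (α → X) → ZFSet.{u} → Prop} {t : (α → X) → ZFSet.{u}}
    (ht : IsDefinableFun A t)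
    (hR : IsDefinable A fun w : α ⊕ Unit → X => R (w ∘ Sum.inl) (w (Sum.inr ()))) :
    IsDefinable A fun v => R v (t v) := by
  have h := ex (R := fun v x => x = t v ∧ R v x) (ht.2.and hR)
  convert h using 3 with v
  simp [ht.1 v]

end IsDefinable

namespace IsDefinableFun

variable {t s : (α → X) → ZFSet.{u}}

theorem var (a : α) : IsDefinableFun A fun v : α → X => (v a : ZFSet.{u}) := by
  refine ⟨fun v => (v a).2, ?_⟩
  simp only [Function.comp_apply, ← Subtype.ext_iff]
  exact ⟨(FirstOrder.Language.Term.var (.inr ())).equal (.var (.inl a)), by ext; simp⟩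

theorem const {p : ZFSet.{u}} (hA : p ∈ A) (hX : p ∈ X) :
    IsDefinableFun A fun _ : α → X => p := by
  refine ⟨fun _ => hX, ?_⟩
  have h := Set.Definable.singleton_of_mem langSet (a := (⟨p, hX⟩ : X)) (A := Subtype.val ⁻¹' A) hA
  simpa [IsDefinable, Subtype.ext_iff] using
    h.preimage_comp fun _ : Fin 1 => (Sum.inr () : α ⊕ Unit)

theorem comp (ht : IsDefinableFun A t) (f : α → β) :
    IsDefinableFun A fun v : β → X => t (v ∘ f) :=
  ⟨fun _ => ht.1 _, ht.2.comp (Sum.map f id)⟩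

theorem lift (ht : IsDefinableFun A t) :
    IsDefinableFun A fun w : α ⊕ Unit → X => t (w ∘ Sum.inl) :=
  ht.comp Sum.inl

theorem last : IsDefinableFun A fun w : α ⊕ Unit → X => (w (Sum.inr ()) : ZFSet.{u}) :=
  var _

end IsDefinableFun

namespace IsDefinable

variable {t s : (α → X) → ZFSet.{u}}

theorem mem (ht : IsDefinableFun A t) (hs : IsDefinableFun A s) :
    IsDefinable A fun v => t v ∈ s v := by
  refine subst (R := fun v y => t v ∈ y) hs (subst (R := fun w x => x ∈ (w (.inr ()) : ZFSet.{u}))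
    ht.lift ?_)
  exact (Set.empty_definable_iff.2 ⟨memSymbol.formula₂ (.var (.inr ())) (.var (.inl (.inr ()))),
    by ext; simp [FirstOrder.Language.Formula.realize_rel₂, relMap_memSymbol]⟩).mono
      (Set.empty_subset _)

theorem eq (ht : IsDefinableFun A t) (hs : IsDefinableFun A s) :
    IsDefinable A fun v => t v = s v :=
  subst (R := fun v x => x = s v) ht hs.2

end IsDefinable

end

section

variable {χ : Cardinal.{u}} {A : Set ZFSet.{u}} {α : Type}

namespace IsDefinable

variable {t s : (α → H χ) → ZFSet.{u}} {R : (α → H χ) → ZFSet.{u} → Prop}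

theorem bex (ht : IsDefinableFun A t)
    (hR : IsDefinable A fun w : α ⊕ Unit → H χ => R (w ∘ Sum.inl) (w (Sum.inr ()))) :
    IsDefinable A fun v => ∃ x ∈ t v, R v x := by
  have h := ex (R := fun v x => x ∈ t v ∧ R v x) ((mem .last ht.lift).and hR)
  convert h using 4 with v x
  exact ⟨fun hx => ⟨mem_H_of_mem (ht.1 v) hx.1, hx⟩, And.right⟩

theorem ball (ht : IsDefinableFun A t)
    (hR : IsDefinable A fun w : α ⊕ Unit → H χ => R (w ∘ Sum.inl) (w (Sum.inr ()))) :
    IsDefinable A fun v => ∀ x ∈ t v, R v x := by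
  simpa only [not_exists, not_and, not_not] using (bex (R := fun v x => ¬R v x) ht hR.not).not

theorem subset (ht : IsDefinableFun A t) (hs : IsDefinableFun A s) :
    IsDefinable A fun v => t v ⊆ s v :=
  ball (R := fun v x => x ∈ s v) ht (.mem .last hs.lift)

theorem exists_subset {R : (α → H χ) → Set ZFSet.{u} → Prop} (ht : IsDefinableFun A t)
    (hR : IsDefinable A fun w : α ⊕ Unit → H χ => R (w ∘ Sum.inl) (w (Sum.inr ()) : ZFSet.{u})) :
    IsDefinable A fun v => ∃ Y ⊆ (t v : Set ZFSet.{u}), R v Y := by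
  have h := ex (R := fun v y => y ⊆ t v ∧ R v y) ((subset .last ht.lift).and hR)
  convert h using 3 with v
  constructor
  · rintro ⟨Y, hY, hRY⟩
    obtain ⟨y, rfl⟩ := exists_coe_eq_of_subset hY
    exact ⟨y, mem_H_of_subset (ht.1 v) hY, hY, hRY⟩
  · rintro ⟨y, _, hy, hRy⟩
    exact ⟨y, hy, hRy⟩

theorem forall_subset {R : (α → H χ) → Set ZFSet.{u} → Prop} (ht : IsDefinableFun A t)
    (hR : IsDefinable A fun w : α ⊕ Unit → H χ => R (w ∘ Sum.inl) (w (Sum.inr ()) : ZFSet.{u})) :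
    IsDefinable A fun v => ∀ Y ⊆ (t v : Set ZFSet.{u}), R v Y := by
  simpa only [not_exists, not_and, not_not] using
    (exists_subset (R := fun v Y => ¬R v Y) ht hR.not).not

theorem isTransitive (ht : IsDefinableFun A t) : IsDefinable A fun v => (t v).IsTransitive :=
  ball (R := fun v x => x ⊆ t v) ht (.subset .last ht.lift)

theorem isOrdinal (ht : IsDefinableFun A t) : IsDefinable A fun v => (t v).IsOrdinal := by
  simp only [isOrdinal_iff_forall_mem_isTransitive]
  exact (isTransitive ht).and (ball ht (isTransitive .last))

end IsDefinable

namespace IsDefinableFun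

variable {t s : (α → H χ) → ZFSet.{u}}

theorem of_mem (hH : ∀ v, t v ∈ H χ)
    (ht : IsDefinable A fun w : α ⊕ Unit → H χ => (w (Sum.inr ()) : ZFSet.{u}) ∈ t (w ∘ Sum.inl)) :
    IsDefinableFun A t := by
  refine ⟨hH, ?_⟩
  have h := IsDefinable.all (R := fun (w : α ⊕ Unit → H χ) x =>
    x ∈ (w (Sum.inr ()) : ZFSet.{u}) ↔ x ∈ t (w ∘ Sum.inl))
    ((IsDefinable.mem .last (var (Sum.inr ())).lift).iff (ht.comp (Sum.map Sum.inl id)))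
  convert h using 3 with w
  refine ⟨fun hw _ _ => by rw [hw], fun hw => ZFSet.ext fun x => ⟨fun hx => ?_, fun hx => ?_⟩⟩
  · exact (hw x (mem_H_of_mem (w (Sum.inr ())).2 hx)).1 hx
  · exact (hw x (mem_H_of_mem (hH _) hx)).2 hx

theorem inter (ht : IsDefinableFun A t) (hs : IsDefinableFun A s) :
    IsDefinableFun A fun v => t v ∩ s v := by
  refine .of_mem (fun v => mem_H_of_subset (ht.1 v) fun x hx => (mem_inter.1 hx).1) ?_
  simp only [mem_inter]
  exact (IsDefinable.mem .last ht.lift).and (.mem .last hs.lift)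

theorem sep {R : (α → H χ) → ZFSet.{u} → Prop} (ht : IsDefinableFun A t)
    (hR : IsDefinable A fun w : α ⊕ Unit → H χ => R (w ∘ Sum.inl) (w (Sum.inr ()))) :
    IsDefinableFun A fun v => (t v).sep (R v) := by
  refine .of_mem (fun v => mem_H_of_subset (ht.1 v) (sep_subset ..)) ?_
  simp only [mem_sep]
  exact (IsDefinable.mem .last ht.lift).and hR

variable (hχ : χ.IsRegular) (h0 : ℵ₀ < χ)
include hχ h0

theorem doubleton (ht : IsDefinableFun A t) (hs : IsDefinableFun A s) :
    IsDefinableFun A fun v => ({t v, s v} : ZFSet.{u}) := by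
  refine .of_mem (fun v => (isCountablyClosed_H hχ h0).doubleton_mem (ht.1 v) (hs.1 v)) ?_
  simp only [mem_pair, or_iff_not_imp_left]
  exact (IsDefinable.eq .last ht.lift).not.imp (.eq .last hs.lift)

theorem pair (ht : IsDefinableFun A t) (hs : IsDefinableFun A s) :
    IsDefinableFun A fun v => ZFSet.pair (t v) (s v) := by
  have hpair : ∀ x y : ZFSet.{u}, ZFSet.pair x y = {{x, x}, {x, y}} := fun x y => by
    rw [pair_eq_singleton, ZFSet.pair]
  simp only [hpair]
  exact (ht.doubleton hχ h0 ht).doubleton hχ h0 (ht.doubleton hχ h0 hs)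

end IsDefinableFun

/-- The set of pairs `g` restricts to a function from a subset of `w` onto `x`. -/
def Enumerates (g w x : ZFSet.{u}) : Prop :=
  ∀ y ∈ x, ∃ a ∈ w, ZFSet.pair a y ∈ g ∧ ∀ z ∈ x, ZFSet.pair a z ∈ g → z = y

section

variable (hχ : χ.IsRegular) (h0 : ℵ₀ < χ)
include hχ h0

theorem card_le_iff_exists_enumerates {x w : ZFSet.{u}} (hx : x ∈ H χ) (hw : w ∈ H χ) :
    x.card ≤ w.card ↔ ∃ g ∈ H χ, Enumerates g w x := by
  have hcard : x.card ≤ w.card ↔ #(x : Set ZFSet.{u}) ≤ #(w : Set ZFSet.{u}) := by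
    rw [mk_coe, mk_coe, Cardinal.lift_le]
  rw [hcard]
  constructor
  · rintro ⟨i⟩
    have hsub : (Set.range fun y => ZFSet.pair (i y) y.1) ⊆ (prod w x : Set ZFSet.{u}) := by
      rintro _ ⟨y, rfl⟩
      exact pair_mem_prod.2 ⟨(i y).2, y.2⟩
    obtain ⟨g, hg⟩ := exists_coe_eq_of_subset hsub
    have hmem : ∀ z, z ∈ g ↔ ∃ y, ZFSet.pair (i y) y.1 = z := fun z => Set.ext_iff.1 hg z
    refine ⟨g, mem_H_of_subset (prod_mem_H hχ h0 hw hx) (hg.trans_subset hsub), fun y hy =>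
      ⟨i ⟨y, hy⟩, (i _).2, (hmem _).2 ⟨⟨y, hy⟩, rfl⟩, fun z _ hz => ?_⟩⟩
    obtain ⟨z', hz'⟩ := (hmem _).1 hz
    obtain ⟨hi, rfl⟩ := pair_injective hz'
    exact congrArg Subtype.val (i.injective (Subtype.val_injective hi))
  · rintro ⟨g, -, hg⟩
    choose a ha hag huniq using hg
    refine ⟨⟨fun y => ⟨a y y.2, ha _ y.2⟩, fun y z hyz => ?_⟩⟩
    have hyz' : a y y.2 = a z z.2 := congrArg Subtype.val hyz
    exact Subtype.ext (huniq z z.2 y y.2 (hyz' ▸ hag y y.2))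

theorem IsDefinable.enumerates {r s t : (α → H χ) → ZFSet.{u}} (hr : IsDefinableFun A r)
    (hs : IsDefinableFun A s) (ht : IsDefinableFun A t) :
    IsDefinable A fun v => Enumerates (r v) (s v) (t v) := by
  refine .ball ht (.bex hs.lift ((IsDefinable.mem ?_ hr.lift.lift).and
    (.ball ht.lift.lift (.imp (.mem ?_ hr.lift.lift.lift) (.eq ?_ ?_)))))
  · exact IsDefinableFun.last.pair hχ h0 IsDefinableFun.last.lift
  · exact IsDefinableFun.last.lift.pair hχ h0 .last
  · exact .last
  · exact IsDefinableFun.last.lift.lift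

theorem IsDefinable.card_le {s t : (α → H χ) → ZFSet.{u}} (hs : IsDefinableFun A s)
    (ht : IsDefinableFun A t) : IsDefinable A fun v => (s v).card ≤ (t v).card := by
  simp only [fun v => card_le_iff_exists_enumerates hχ h0 (hs.1 v) (ht.1 v)]
  exact .ex (.enumerates hχ h0 .last ht.lift hs.lift)

end

end

namespace IsElementarySubmodel

theorem exists_mem {M X : Set ZFSet.{u}} (hM : IsElementarySubmodel M X) {R : ZFSet.{u} → Prop}
    (hR : IsDefinable M fun w : Unit → X => R (w ())) (h : ∃ x ∈ X, R x) : ∃ x ∈ M, R x := by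
  obtain ⟨S, rfl⟩ := hM
  obtain ⟨φ, hφ⟩ := Set.definable_iff_exists_formula_sum.1 hR
  have hφR : ∀ i : Unit → X, R (i ()) ↔ φ.Realize (Sum.elim Subtype.val i) := Set.ext_iff.1 hφ
  let w : (Subtype.val ⁻¹' (Subtype.val '' (S : Set X)) : Set X) → S := fun a =>
    ⟨a, by obtain ⟨a', ha', h⟩ := a.2; exact Subtype.ext h ▸ ha'⟩
  obtain ⟨x, hx, hRx⟩ := h
  have hex : (φ.iExs Unit).Realize (S.subtype ∘ w) :=
    FirstOrder.Language.Formula.realize_iExs.2 ⟨fun _ => ⟨x, hx⟩, (hφR fun _ => ⟨x, hx⟩).1 hRx⟩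
  rw [S.subtype.map_formula, FirstOrder.Language.Formula.realize_iExs] at hex
  obtain ⟨i, hi⟩ := hex
  rw [← S.subtype.map_formula, Sum.comp_elim] at hi
  exact ⟨i (), ⟨i (), (i ()).2, rfl⟩, (hφR (S.subtype ∘ i)).2 hi⟩

variable {χ : Cardinal.{u}} {M : Set ZFSet.{u}} (hM : IsElementarySubmodel M (H χ))
  {x y w : ZFSet.{u}} {α : Type}
include hM

theorem const (hx : x ∈ M) : IsDefinableFun M fun _ : α → H χ => x :=
  .const hx (hM.subset hx)

theorem mem_of_isDefinableFun (hx : IsDefinableFun M fun _ : Empty → H χ => x) : x ∈ M := by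
  obtain ⟨y, hy, rfl⟩ := hM.exists_mem (R := (· = x)) (hx.2.comp fun _ => ())
    ⟨x, hx.1 Empty.elim, rfl⟩
  exact hy

theorem inter_mem (hx : x ∈ M) (hy : y ∈ M) : x ∩ y ∈ M :=
  hM.mem_of_isDefinableFun ((hM.const hx).inter (hM.const hy))

theorem pair_mem (hχ : χ.IsRegular) (h0 : ℵ₀ < χ) (hx : x ∈ M) (hy : y ∈ M) : pair x y ∈ M :=
  hM.mem_of_isDefinableFun ((hM.const hx).pair hχ h0 (hM.const hy))

theorem mem_of_pair_mem (hχ : χ.IsRegular) (h0 : ℵ₀ < χ) (h : pair x y ∈ M) : x ∈ M ∧ y ∈ M := by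
  have hxy : ({x, y} : ZFSet.{u}) ∈ H χ := mem_H_of_mem (hM.subset h) (by simp [pair])
  have hx : x ∈ H χ := mem_H_of_mem hxy (by simp)
  have hy : y ∈ H χ := mem_H_of_mem hxy (by simp)
  constructor
  · obtain ⟨x', hx', y', _, h'⟩ := hM.exists_mem
      (R := fun x' => ∃ y' ∈ H χ, pair x' y' = pair x y)
      (.ex (.eq (.pair hχ h0 (IsDefinableFun.var ()).lift .last) (hM.const h))) ⟨x, hx, y, hy, rfl⟩
    exact (pair_injective h').1 ▸ hx'
  · obtain ⟨y', hy', x', _, h'⟩ := hM.exists_mem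
      (R := fun y' => ∃ x' ∈ H χ, pair x' y' = pair x y)
      (.ex (.eq (.pair hχ h0 .last (IsDefinableFun.var ()).lift) (hM.const h))) ⟨y, hy, x, hx, rfl⟩
    exact (pair_injective h').2 ▸ hy'

theorem coe_subset_of_card_le (hχ : χ.IsRegular) (h0 : ℵ₀ < χ) (hw : w ∈ M)
    (hwM : (w : Set ZFSet.{u}) ⊆ M) (hx : x ∈ M) (h : x.card ≤ w.card) :
    (x : Set ZFSet.{u}) ⊆ M := by
  obtain ⟨g, hg, hgx⟩ := hM.exists_mem (R := (Enumerates · w x))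
    (.enumerates hχ h0 (.var ()) (hM.const hw) (hM.const hx))
    ((card_le_iff_exists_enumerates hχ h0 (hM.subset hx) (hM.subset hw)).1 h)
  intro y hy
  obtain ⟨a, ha, hay, huniq⟩ := hgx y hy
  obtain ⟨z, hz, hzx, haz⟩ := hM.exists_mem (R := fun z => z ∈ x ∧ pair a z ∈ g)
    ((IsDefinable.mem (.var ()) (hM.const hx)).and
      (.mem (.pair hχ h0 (hM.const (hwM ha)) (.var ())) (hM.const hg)))
    ⟨y, mem_H_of_mem (hM.subset hx) hy, hy, hay⟩
  exact huniq z hzx haz ▸ hz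

end IsElementarySubmodel

theorem not_countable_omegaOne : ¬(omegaOne.{u} : Set ZFSet.{u}).Countable := by
  rw [← Cardinal.le_aleph0_iff_set_countable, mk_omegaOne, not_le]
  exact aleph0_lt_aleph_one

theorem isOrdinal_omegaOne : omegaOne.{u}.IsOrdinal :=
  isOrdinal_toZFSet _

theorem mem_omegaOne_iff {x : ZFSet.{u}} :
    x ∈ omegaOne ↔ x.IsOrdinal ∧ (x : Set ZFSet.{u}).Countable := by
  have hlt (o : Ordinal.{u}) : o.toZFSet ∈ omegaOne ↔ (o.toZFSet : Set ZFSet.{u}).Countable := by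
    rw [omegaOne, toZFSet_mem_toZFSet_iff, countable_coe_iff, card_toZFSet, ← Cardinal.ord_aleph,
      Cardinal.lt_ord, ← Order.lt_succ_iff, Cardinal.succ_aleph0]
  constructor
  · intro hx
    have hord := isOrdinal_omegaOne.mem hx
    rw [← hord.toZFSet_rank_eq, hlt, hord.toZFSet_rank_eq] at hx
    exact ⟨hord, hx⟩
  · rintro ⟨hord, hx⟩
    rwa [← hord.toZFSet_rank_eq, hlt, hord.toZFSet_rank_eq]

theorem eq_omegaOne_iff {o : ZFSet.{u}} :
    o = omegaOne ↔ o.IsOrdinal ∧ ¬(o : Set ZFSet.{u}).Countable ∧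
      ∀ a ∈ o, (a : Set ZFSet.{u}).Countable := by
  constructor
  · rintro rfl
    exact ⟨isOrdinal_omegaOne, not_countable_omegaOne, fun a ha => (mem_omegaOne_iff.1 ha).2⟩
  · rintro ⟨hord, hunc, hc⟩
    rcases hord.mem_trichotomous isOrdinal_omegaOne with h | h | h
    · exact absurd (mem_omegaOne_iff.1 h).2 hunc
    · exact h
    · exact absurd (hc _ h) not_countable_omegaOne

theorem IsCountablyClosed.omegaOne_subset {X : Set ZFSet.{u}} (hX : IsCountablyClosed X) :
    (omegaOne : Set ZFSet.{u}) ⊆ X := by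
  intro x
  induction x using ZFSet.inductionOn with
  | _ x ih =>
    exact fun hx => hX x (fun y hy => ih y hy (isOrdinal_omegaOne.mem_trans hy hx))
      (mem_omegaOne_iff.1 hx).2

namespace goodModels

variable {χ : Cardinal.{u}} {M : Set ZFSet.{u}} (hM : M ∈ goodModels χ) {x : ZFSet.{u}} {α : Type}
include hM

theorem isCountablyCovered : IsCountablyCovered M :=
  (cofinalIn_countableMembers_iff hM.2.1).1 hM.2.2

theorem exists_mem_card_eq_aleph0 : ∃ w ∈ M, (w : Set ZFSet.{u}) ⊆ M ∧ w.card = ℵ₀ := by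
  obtain ⟨Z, hZ⟩ := Cardinal.le_mk_iff_exists_subset.1
    ((Cardinal.aleph0_le_aleph 1).trans hM.2.1.ge)
  obtain ⟨_, ⟨⟨hwM, hw⟩, w, hmem, rfl⟩, -⟩ := hM.2.2 Z hZ
  rw [mk_coe, Cardinal.lift_eq_aleph0] at hw
  exact ⟨w, hmem, hwM, hw⟩

variable (hχ : χ.IsRegular) (h0 : ℵ₀ < χ)
include hχ h0

theorem isDefinable_countable {t : (α → H χ) → ZFSet.{u}} (ht : IsDefinableFun M t) :
    IsDefinable M fun v => (t v : Set ZFSet.{u}).Countable := by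
  obtain ⟨w, hw, -, hcard⟩ := exists_mem_card_eq_aleph0 hM
  simp only [countable_coe_iff, ← hcard]
  exact .card_le hχ h0 ht (hM.1.const hw)

theorem coe_subset_of_countable (hx : x ∈ M) (hc : (x : Set ZFSet.{u}).Countable) :
    (x : Set ZFSet.{u}) ⊆ M := by
  obtain ⟨w, hw, hwM, hcard⟩ := exists_mem_card_eq_aleph0 hM
  exact hM.1.coe_subset_of_card_le hχ h0 hw hwM hx (hcard ▸ countable_coe_iff.1 hc)

omit h0

theorem omegaOne_mem (h1 : ℵ₁ < χ) : omegaOne ∈ M := by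
  have h0 := aleph0_lt_aleph_one.trans h1
  obtain ⟨o, ho, rfl⟩ := hM.1.exists_mem (R := (· = omegaOne)) (by
    simp only [eq_omegaOne_iff]
    exact (IsDefinable.isOrdinal (.var ())).and ((isDefinable_countable hM hχ h0 (.var ())).not.and
      (.ball (.var ()) (isDefinable_countable hM hχ h0 .last)))) ⟨_, omegaOne_mem_H h1, rfl⟩
  exact ho

theorem omegaOne_subset (h1 : ℵ₁ < χ) : (omegaOne : Set ZFSet.{u}) ⊆ M := by
  have h0 := aleph0_lt_aleph_one.trans h1
  obtain ⟨z, hz⟩ := exists_coe_eq_of_subset (Set.inter_subset_left (s := omegaOne) (t := M))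
  have hmem : ∀ a, a ∈ z ↔ a ∈ omegaOne ∧ a ∈ M := Set.ext_iff.1 hz
  have hord : z.IsOrdinal := by
    rw [isOrdinal_iff_forall_mem_isTransitive]
    refine ⟨fun a ha b hb => ?_, fun a ha =>
      (isOrdinal_omegaOne.mem ((hmem a).1 ha).1).isTransitive⟩
    obtain ⟨ha, haM⟩ := (hmem a).1 ha
    exact (hmem b).2 ⟨isOrdinal_omegaOne.mem_trans hb ha,
      coe_subset_of_countable hM hχ h0 haM (mem_omegaOne_iff.1 ha).2 hb⟩
  rcases (hord.subset_iff_eq_or_mem isOrdinal_omegaOne).1 fun a ha => ((hmem a).1 ha).1 with h | h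
  · exact fun a ha => ((hmem a).1 (h ▸ ha)).2
  · obtain ⟨y, hy, hzy, hyM, -⟩ := isCountablyCovered hM z (fun a ha => ((hmem a).1 ha).2)
      (mem_omegaOne_iff.1 h).2
    have hyz : y ∩ omegaOne = z := ZFSet.ext fun a => by
      rw [mem_inter, hmem]
      exact ⟨fun ha => ⟨ha.2, hyM ha.1⟩, fun ha => ⟨hzy ((hmem a).2 ha), ha.1⟩⟩
    have hzM : z ∈ M := hyz ▸ hM.1.inter_mem hy (omegaOne_mem hM hχ h1)
    exact absurd ((hmem z).2 ⟨h, hzM⟩) (mem_irrefl z)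

end goodModels

namespace SetPoset

variable {P : SetPoset.{u}} {χ : Cardinal.{u}} {M : Set ZFSet.{u}} {α : Type}
  {r s t : (α → H χ) → ZFSet.{u}} {D f : ZFSet.{u}}

theorem isReflecting_iff {D : Set ZFSet.{u}} {R : ZFSet.{u} → ZFSet.{u} → Prop}
    {N : Set ZFSet.{u}} : P.IsReflecting D R N ↔ N ⊆ D ∧ #N ≤ ℵ₁ ∧
      (omegaOne : Set ZFSet.{u}) ⊆ N ∧ (∀ a ∈ N, ∀ b ∈ N, pair a b ∈ N) ∧
      (∀ a ∈ N, ∃ b ∈ N, R a b) ∧ IsCountablyCovered N ∧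
      P.LeSigma ((P.carrier : Set ZFSet.{u}) ∩ N) :=
  ⟨fun ⟨h₁, h₂, h₃, h₄, h₅, h₆, h₇⟩ => ⟨h₁, h₂, h₃, h₄, h₅, h₆, h₇⟩,
    fun ⟨h₁, h₂, h₃, h₄, h₅, h₆, h₇⟩ => ⟨h₁, h₂, h₃, h₄, h₅, h₆, h₇⟩⟩

/-- The relation coded by `f` is total on the countably closed set `D`, which includes `P`, but no
subset of `D` reflects it. -/
def IsCounterexample (P : SetPoset.{u}) (D f : ZFSet.{u}) : Prop :=
  P.carrier ⊆ D ∧ IsCountablyClosed (D : Set ZFSet.{u}) ∧ (∀ a ∈ D, ∃ b ∈ D, pair a b ∈ f) ∧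
    ∀ N ⊆ (D : Set ZFSet.{u}), ¬P.IsReflecting D (pair · · ∈ f) N

namespace models

variable (hχ : χ.IsRegular) (h0 : ℵ₀ < χ) (hM : M ∈ P.models χ)
include hχ h0 hM

theorem carrier_mem : P.carrier ∈ M :=
  (hM.1.1.mem_of_pair_mem hχ h0 hM.2.1).1

theorem isDefinable_le (hs : IsDefinableFun M s) (ht : IsDefinableFun M t) :
    IsDefinable M fun v => P.Le (s v) (t v) :=
  .mem (hs.pair hχ h0 ht) (hM.1.1.const (hM.1.1.mem_of_pair_mem hχ h0 hM.2.1).2)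

theorem isDefinable_exists_countable_cofinal {R : ZFSet.{u} → ZFSet.{u} → Prop}
    (hR : ∀ {β : Type} {s t : (β → H χ) → ZFSet.{u}}, IsDefinableFun M s → IsDefinableFun M t →
      IsDefinable M fun v => R (s v) (t v))
    (hs : IsDefinableFun M s) (ht : IsDefinableFun M t) :
    IsDefinable M fun v => ∃ C ⊆ {q ∈ (s v : Set ZFSet.{u}) | R q (t v)},
      C.Countable ∧ ∀ q ∈ s v, R q (t v) → ∃ c ∈ C, R q c := by
  have hsep : IsDefinableFun M fun v => (s v).sep fun q => R q (t v) :=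
    hs.sep (R := fun v q => R q (t v)) (hR .last ht.lift)
  have h := IsDefinable.exists_subset (R := fun v C => C.Countable ∧
    ∀ q ∈ s v, R q (t v) → ∃ c ∈ C, R q c) hsep
    ((goodModels.isDefinable_countable hM.1 hχ h0 .last).and
      (.ball hs.lift (.imp (hR .last ht.lift.lift) (.bex (IsDefinableFun.last).lift
        (hR (IsDefinableFun.last).lift .last)))))
  simp only [coe_sep] at h
  exact h

theorem isDefinable_leSigma_inter (ht : IsDefinableFun M t) :
    IsDefinable M fun v => P.LeSigma ((P.carrier : Set ZFSet.{u}) ∩ t v) := by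
  have hc {β : Type} : IsDefinableFun M fun _ : β → H χ => P.carrier :=
    hM.1.1.const (carrier_mem hχ h0 hM)
  simp only [LeSigma, ← coe_inter]
  refine .and (.subset (hc.inter ht) hc) (.ball hc (.and ?_ ?_))
  · exact isDefinable_exists_countable_cofinal (R := P.Le) hχ h0 hM (isDefinable_le hχ h0 hM)
      (hc.inter ht.lift) .last
  · exact isDefinable_exists_countable_cofinal (R := fun q p => P.Le p q) hχ h0 hM
      (fun hs ht => isDefinable_le hχ h0 hM ht hs) (hc.inter ht.lift) .last

theorem isDefinable_isCountablyCovered (ht : IsDefinableFun M t) :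
    IsDefinable M fun v => IsCountablyCovered (t v) := by
  have hcount {β : Type} {s : (β → H χ) → ZFSet.{u}} (hs : IsDefinableFun M s) :=
    goodModels.isDefinable_countable hM.1 hχ h0 hs
  exact .forall_subset ht (.imp (hcount .last) (.bex ht.lift
    ((IsDefinable.subset (IsDefinableFun.last).lift .last).and
      ((IsDefinable.subset .last ht.lift.lift).and (hcount .last)))))

omit h0

theorem isDefinable_isReflecting (h1 : ℵ₁ < χ) (hr : IsDefinableFun M r) (hs : IsDefinableFun M s)
    (ht : IsDefinableFun M t) :
    IsDefinable M fun v => P.IsReflecting (r v) (pair · · ∈ s v) (t v) := by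
  have h0 := aleph0_lt_aleph_one.trans h1
  have hω {β : Type} : IsDefinableFun M fun _ : β → H χ => omegaOne :=
    hM.1.1.const (goodModels.omegaOne_mem hM.1 hχ h1)
  have hcard (v : α → H χ) : #(t v : Set ZFSet.{u}) ≤ ℵ₁ ↔ (t v).card ≤ omegaOne.card := by
    rw [← mk_omegaOne, mk_coe, mk_coe, Cardinal.lift_le]
  simp only [isReflecting_iff, hcard]
  refine (IsDefinable.subset ht hr).and ((IsDefinable.card_le hχ h0 ht hω).and
    ((IsDefinable.subset hω ht).and (.and ?_ (.and ?_
      ((isDefinable_isCountablyCovered hχ h0 hM ht).and (isDefinable_leSigma_inter hχ h0 hM ht))))))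
  · exact .ball ht (.ball ht.lift
      (.mem (.pair hχ h0 (IsDefinableFun.last).lift .last) ht.lift.lift))
  · exact .ball ht (.bex ht.lift (.mem (.pair hχ h0 (IsDefinableFun.last).lift .last) hs.lift.lift))

theorem isDefinable_isCounterexample (h1 : ℵ₁ < χ) (hs : IsDefinableFun M s)
    (ht : IsDefinableFun M t) : IsDefinable M fun v => P.IsCounterexample (s v) (t v) := by
  have h0 := aleph0_lt_aleph_one.trans h1
  have hclosed (v : α → H χ) : IsCountablyClosed (s v : Set ZFSet.{u}) ↔
      ∀ y ∈ H χ, y ⊆ s v → (y : Set ZFSet.{u}).Countable → y ∈ s v :=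
    ⟨fun h y _ => h y, fun h y hy => h y (mem_H_of_subset (hs.1 v) hy) hy⟩
  simp only [IsCounterexample, hclosed]
  refine (IsDefinable.subset (hM.1.1.const (carrier_mem hχ h0 hM)) hs).and (.and ?_ (.and ?_ ?_))
  · exact .all ((IsDefinable.subset .last hs.lift).imp
      ((goodModels.isDefinable_countable hM.1 hχ h0 .last).imp (.mem .last hs.lift)))
  · exact .ball hs (.bex hs.lift (.mem (.pair hχ h0 (IsDefinableFun.last).lift .last) ht.lift.lift))
  · exact .forall_subset hs (isDefinable_isReflecting hχ hM h1 hs.lift ht.lift .last).not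

theorem isReflecting_coe_inter (h1 : ℵ₁ < χ) (hD : D ∈ M) (hf : f ∈ M) (hcD : P.carrier ⊆ D)
    (hclosed : IsCountablyClosed (D : Set ZFSet.{u})) (htot : ∀ a ∈ D, ∃ b ∈ D, pair a b ∈ f) :
    P.IsReflecting D (pair · · ∈ f) (D ∩ M) where
  subset := Set.inter_subset_left
  mk_le := (Cardinal.mk_le_mk_of_subset Set.inter_subset_right).trans hM.1.2.1.le
  omegaOne_subset := Set.subset_inter hclosed.omegaOne_subset
    (goodModels.omegaOne_subset hM.1 hχ h1)
  pair_mem a ha b hb := ⟨hclosed.pair_mem ha.1 hb.1,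
    hM.1.1.pair_mem hχ (aleph0_lt_aleph_one.trans h1) ha.2 hb.2⟩
  exists_rel a ha := by
    obtain ⟨b, hbD, hab⟩ := htot a ha.1
    obtain ⟨b, hbM, hbD, hab⟩ := hM.1.1.exists_mem (R := fun b => b ∈ D ∧ pair a b ∈ f)
      ((IsDefinable.mem (.var ()) (hM.1.1.const hD)).and (.mem (.pair hχ
        (aleph0_lt_aleph_one.trans h1) (hM.1.1.const ha.2) (.var ())) (hM.1.1.const hf)))
      ⟨b, mem_H_of_mem (hM.1.1.subset hD) hbD, hbD, hab⟩
    exact ⟨b, ⟨hbD, hbM⟩, hab⟩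
  isCountablyCovered Y hY hYc := by
    obtain ⟨y, hy, hYy, hyM, hyc⟩ :=
      goodModels.isCountablyCovered hM.1 Y (fun a ha => (hY ha).2) hYc
    have hsub : ((D ∩ y : ZFSet.{u}) : Set ZFSet.{u}) ⊆ y := fun a ha => (mem_inter.1 ha).2
    have hsubD : ((D ∩ y : ZFSet.{u}) : Set ZFSet.{u}) ⊆ D := fun a ha => (mem_inter.1 ha).1
    exact ⟨D ∩ y, ⟨hclosed _ hsubD (hyc.mono hsub), hM.1.1.inter_mem hD hy⟩,
      fun a ha => mem_inter.2 ⟨(hY ha).1, hYy ha⟩, Set.subset_inter hsubD (hsub.trans hyM),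
      hyc.mono hsub⟩
  leSigma := by
    rw [← Set.inter_assoc, Set.inter_eq_left.2 (show (P.carrier : Set ZFSet.{u}) ⊆ D from hcD)]
    exact hM.2.2

theorem not_isCounterexample (h1 : ℵ₁ < χ) (hD : D ∈ H χ) (hf : f ∈ H χ) :
    ¬P.IsCounterexample D f := by
  intro h
  obtain ⟨D, hD, f, hf, h⟩ := hM.1.1.exists_mem (R := fun D => ∃ f ∈ H χ, P.IsCounterexample D f)
    (.ex (isDefinable_isCounterexample hχ hM h1 (IsDefinableFun.var ()).lift .last))
    ⟨D, hD, f, hf, h⟩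
  obtain ⟨f, hf, hcD, hclosed, htot, hN⟩ := hM.1.1.exists_mem (R := P.IsCounterexample D)
    (isDefinable_isCounterexample hχ hM h1 (hM.1.1.const hD) (.var ())) ⟨f, hf, h⟩
  exact hN _ Set.inter_subset_left (isReflecting_coe_inter hχ hM h1 hD hf hcD hclosed htot)

theorem hasReflection (h1 : ℵ₁ < χ) (hD : D ∈ H χ) (hcD : P.carrier ⊆ D)
    (hclosed : IsCountablyClosed (D : Set ZFSet.{u})) : P.HasReflection D := by
  intro R htot
  let f := (prod D D).sep fun z => ∃ a b, pair a b = z ∧ R a b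
  have hpair : ∀ a b, pair a b ∈ f ↔ (a ∈ D ∧ b ∈ D) ∧ R a b := fun a b => by
    simp only [f, mem_sep, pair_mem_prod, pair_inj]
    exact and_congr_right' ⟨fun ⟨_, _, ⟨ha, hb⟩, h⟩ => ha ▸ hb ▸ h, fun h => ⟨a, b, ⟨rfl, rfl⟩, h⟩⟩
  have hf : f ∈ H χ := mem_H_of_subset
    (prod_mem_H hχ (aleph0_lt_aleph_one.trans h1) hD hD) sep_subset
  by_contra hcontra
  refine not_isCounterexample hχ hM h1 hD hf
    ⟨hcD, hclosed, fun a ha => ?_, fun N _ hN => hcontra ⟨N, ?_⟩⟩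
  · obtain ⟨b, hb, hab⟩ := htot a ha
    exact ⟨b, hb, (hpair a b).2 ⟨⟨ha, hb⟩, hab⟩⟩
  · refine { hN with exists_rel := fun a ha => ?_ }
    obtain ⟨b, hb, hab⟩ := hN.exists_rel a ha
    exact ⟨b, hb, ((hpair a b).1 hab).2⟩

end models
end SetPoset

/-- The arities of the well-founded trees coding the members of `H κ⁺`, where `K` has cardinality
`κ`: a leaf codes the empty set, an inner node the set coded by its `K` subtrees. -/
def Arity (K : Type u) : Bool → Type u
  | false => PEmpty
  | true => K

/-- The set coded by a well-founded tree. -/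
noncomputable def decode {K : Type u} : WType (Arity K) → ZFSet.{u} :=
  WType.elim ZFSet.{u} fun x => ZFSet.range x.2

theorem mk_wType_arity_le (K : Type u) [Infinite K] : #(WType (Arity K)) ≤ 2 ^ #K := by
  have hK : ℵ₀ ≤ #K := Cardinal.aleph0_le_mk K
  have h2 : ℵ₀ ≤ (2 : Cardinal.{u}) ^ #K := hK.trans (Cardinal.cantor _).le
  have hpow (b : Bool) : ((2 : Cardinal.{u}) ^ #K) ^ #(Arity K b) ≤ 2 ^ #K := by
    cases b
    · simpa [Arity] using Cardinal.one_le_aleph0.trans h2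
    · simp [Arity, ← Cardinal.power_mul, Cardinal.mul_eq_self hK]
  refine WType.cardinalMk_le_of_le' ?_
  calc Cardinal.sum (fun b => ((2 : Cardinal.{u}) ^ #K) ^ Cardinal.lift.{0} #(Arity K b))
      ≤ Cardinal.sum fun _ : Bool => (2 : Cardinal.{u}) ^ #K :=
        Cardinal.sum_le_sum _ _ fun b => by simpa only [Cardinal.lift_uzero] using hpow b
    _ ≤ 2 ^ #K := by
        have h2' := (Cardinal.natCast_lt_aleph0 (n := 2)).le.trans h2
        simpa using Cardinal.mul_le_of_le h2 h2' le_rfl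

theorem exists_decode_eq {K : Type u} {x : ZFSet.{u}} (hx : x ∈ H (Order.succ #K)) :
    ∃ w : WType (Arity K), decode w = x := by
  induction x using ZFSet.inductionOn with
  | _ x ih =>
    choose w hw using fun y : x => ih y y.2 (mem_H_of_mem hx y.2)
    rcases x.eq_empty_or_nonempty with rfl | ⟨y, hy⟩
    · refine ⟨⟨false, PEmpty.elim⟩, ZFSet.ext fun z => ?_⟩
      exact mem_range.trans ⟨fun ⟨k, _⟩ => k.elim, fun hz => absurd hz (notMem_empty z)⟩
    · obtain ⟨i⟩ := Order.lt_succ_iff.1 (card_lt_of_mem_H hx)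
      have : Nonempty (Shrink x) := ⟨equivShrink x ⟨y, hy⟩⟩
      have hsurj := (equivShrink x).symm.surjective.comp (Function.invFun_surjective i.injective)
      refine ⟨⟨true, fun k => w ((equivShrink x).symm (Function.invFun i k))⟩,
        ZFSet.ext fun z => ?_⟩
      refine mem_range.trans ⟨fun ⟨k, hk⟩ => ?_, fun hz => ?_⟩
      · exact (hw _).symm.trans hk ▸ Subtype.prop _
      · exact (hsurj ⟨z, hz⟩).imp fun k hk => (hw _).trans (congrArg Subtype.val hk)

theorem exists_coe_eq_H_succ {κ : Cardinal.{u}} (hκ : ℵ₀ ≤ κ) :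
    ∃ D : ZFSet.{u}, (D : Set ZFSet.{u}) = H (Order.succ κ) ∧ D.card ≤ 2 ^ κ := by
  have : Infinite κ.out := Cardinal.infinite_iff.2 (hκ.trans κ.mk_out.ge)
  have hsub : H (Order.succ κ) ⊆ (ZFSet.range (decode (K := κ.out)) : Set ZFSet.{u}) :=
    fun x hx => mem_range.2 (exists_decode_eq (by rwa [κ.mk_out]))
  obtain ⟨D, hD⟩ := exists_coe_eq_of_subset hsub
  refine ⟨D, hD, ?_⟩
  calc D.card ≤ (ZFSet.range (decode (K := κ.out))).card := card_mono (hD.trans_subset hsub)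
    _ ≤ #(WType (Arity κ.out)) := by simpa using lift_card_range_le (f := decode (K := κ.out))
    _ ≤ 2 ^ κ := (mk_wType_arity_le κ.out).trans_eq (by rw [κ.mk_out])

namespace SetPoset

variable {P : SetPoset.{u}} {χ : Cardinal.{u}}

theorem aleph0_le_kappa : ℵ₀ ≤ P.kappa :=
  (Cardinal.aleph0_le_aleph 1).trans (le_max_right _ _)

theorem carrier_subset_H (hκ : P.kappa < χ) : (P.carrier : Set ZFSet.{u}) ⊆ H χ :=
  fun _ hx => mem_H_of_mem (carrier_mem_H hκ) hx

theorem hasReflection_of_nonempty_models (hχ : χ.IsRegular) (hκ : 2 ^ P.kappa < χ)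
    (hne : (P.models χ).Nonempty) : P.HasReflection (H (Order.succ P.kappa)) := by
  obtain ⟨M, hM⟩ := hne
  obtain ⟨D, hD, hcard⟩ := exists_coe_eq_H_succ (aleph0_le_kappa (P := P))
  have hmem : ∀ x, x ∈ D ↔ x ∈ H (Order.succ P.kappa) := Set.ext_iff.1 hD
  have htrans : D.IsTransitive := fun x hx y hy =>
    (hmem y).2 (mem_H_of_mem ((hmem x).1 hx) hy)
  rw [← hD]
  refine models.hasReflection hχ hM (aleph_one_lt_of_kappa_lt ((Cardinal.cantor _).trans hκ))
    (mem_H_of_subset_isTransitive subset_rfl htrans (hcard.trans_lt hκ)) ?_ ?_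
  · exact (carrier_subset_H (Order.lt_succ P.kappa)).trans_eq hD.symm
  · rw [hD]
    exact isCountablyClosed_H (Cardinal.isRegular_succ aleph0_le_kappa)
      (Order.lt_succ_iff.2 aleph0_le_kappa)

theorem hasReflection_of_isStationary (hχ : χ.IsRegular) (hκ : P.kappa < χ)
    (hS : IsStationary (H χ) (P.models χ)) : P.HasReflection (H χ) := by
  intro R htot
  choose! f hf hRf using htot
  have h1 : ℵ₁ < χ := aleph_one_lt_of_kappa_lt hκ
  have h0 : ℵ₀ < χ := aleph0_lt_aleph_one.trans h1
  obtain ⟨N, ⟨hN, -, hσ⟩, -, hωN, hfN⟩ := hS.2 _ (isClub_mapsTo (aleph_one_le_mk_H h1)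
    (isCountablyClosed_H hχ h0).omegaOne_subset mk_omegaOne.le hf)
  exact ⟨N, hN.1.subset, hN.2.1.le, hωN, fun a ha b hb => hN.1.pair_mem hχ h0 ha hb,
    fun a ha => ⟨f a, hfN ha, hRf a (hN.1.subset ha)⟩, goodModels.isCountablyCovered hN, hσ⟩

theorem exists_mem_models_superset (hκ : P.kappa < χ) (hS : IsStationary (H χ) (P.models χ))
    {X : Set ZFSet.{u}} (hX : X ⊆ H χ) (hc : #X ≤ ℵ₁) : ∃ M ∈ P.models χ, X ⊆ M := by
  obtain ⟨M, hM, -, hXM, -⟩ := hS.2 _ (isClub_mapsTo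
    (aleph_one_le_mk_H (aleph_one_lt_of_kappa_lt hκ)) hX hc (Set.mapsTo_id _))
  exact ⟨M, hM, hXM⟩

theorem nonempty_models_of_isStationary (hκ : P.kappa < χ)
    (hS : IsStationary (H χ) (P.models χ)) : (P.models χ).Nonempty := by
  obtain ⟨M, hM, -⟩ := exists_mem_models_superset hκ hS (Set.empty_subset _) (by simp)
  exact ⟨M, hM⟩

theorem sep_of_forall_isStationary
    (h : ∀ χ : Cardinal.{u}, χ.IsRegular → P.kappa < χ → IsStationary (H χ) (P.models χ)) :
    P.SEP := by
  refine ⟨Order.succ P.kappa, fun χ hχ hκ X hX => ?_⟩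
  rw [Order.succ_le_iff] at hκ
  obtain ⟨M, hM, hXM⟩ := exists_mem_models_superset hκ (h χ hχ hκ) hX.1 hX.2.le
  exact ⟨M, ⟨hM.1, hM.2.2⟩, hXM⟩

theorem nonempty_models_of_cofinalIn (hχ : χ.IsRegular) (hκ : P.kappa < χ)
    (hcof : CofinalIn {M ∈ goodModels χ | P.LeSigma ((P.carrier : Set ZFSet.{u}) ∩ M)}
      (subsetsOfCard (H χ) ℵ₁)) : (P.models χ).Nonempty := by
  obtain ⟨X, hX, hcX⟩ := exists_subsetsOfCard (aleph_one_le_mk_H (aleph_one_lt_of_kappa_lt hκ))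
    (Set.singleton_subset_iff.2 (code_mem_H hχ hκ))
    (mk_le_aleph_one_of_countable (Set.countable_singleton _))
  obtain ⟨M, ⟨hM, hσ⟩, hXM⟩ := hcof X hX
  exact ⟨M, hM, hXM (hcX rfl), hσ⟩

end SetPoset

theorem exists_isRegular_gt (κ : Cardinal.{u}) : ∃ χ : Cardinal.{u}, χ.IsRegular ∧ κ < χ :=
  ⟨_, Cardinal.isRegular_succ (le_max_right κ ℵ₀), (le_max_left _ _).trans_lt (Order.lt_succ _)⟩

theorem SetPoset.exists_nonempty_models_of_sep {P : SetPoset.{u}} (h : P.SEP) :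
    ∃ χ : Cardinal.{u}, χ.IsRegular ∧ 2 ^ P.kappa < χ ∧ (P.models χ).Nonempty := by
  obtain ⟨χ₀, hχ₀⟩ := h
  obtain ⟨χ, hχ, hlt⟩ := exists_isRegular_gt (max χ₀ (2 ^ P.kappa))
  obtain ⟨hχ₀χ, hκ⟩ := max_lt_iff.1 hlt
  exact ⟨χ, hχ, hκ, nonempty_models_of_cofinalIn hχ ((Cardinal.cantor _).trans hκ)
    (hχ₀ χ hχ hχ₀χ.le)⟩

end SepPrinciple

theorem theorem8p1 (P : SepPrinciple.SetPoset.{u}) :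
    List.TFAE [
      P.SEP,
      ∃ χ : Cardinal.{u}, χ.IsRegular ∧ P.kappa < χ ∧
        SepPrinciple.IsStationary (SepPrinciple.H χ) (P.models χ),
      ∀ χ : Cardinal.{u}, χ.IsRegular → P.kappa < χ →
        SepPrinciple.IsStationary (SepPrinciple.H χ) (P.models χ),
      ∃ χ : Cardinal.{u}, χ.IsRegular ∧ 2 ^ P.kappa < χ ∧ (P.models χ).Nonempty,
      ∀ χ : Cardinal.{u}, χ.IsRegular → 2 ^ P.kappa < χ → (P.models χ).Nonempty] := by
  tfae_have 1 → 4 := SepPrinciple.SetPoset.exists_nonempty_models_of_sep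
  tfae_have 4 → 3 := fun ⟨_, hχ, hκ, hne⟩ _ hχ' hκ' =>
    (SepPrinciple.SetPoset.hasReflection_of_nonempty_models hχ hκ hne).isStationary
      (SepPrinciple.SetPoset.carrier_subset_H (Order.lt_succ _)) hχ' hκ'
  tfae_have 2 → 3 := fun ⟨_, hχ, hκ, hS⟩ _ hχ' hκ' =>
    (SepPrinciple.SetPoset.hasReflection_of_isStationary hχ hκ hS).isStationary
      (SepPrinciple.SetPoset.carrier_subset_H hκ) hχ' hκ'
  tfae_have 3 → 1 := SepPrinciple.SetPoset.sep_of_forall_isStationary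
  tfae_have 3 → 2 := fun h =>
    (SepPrinciple.exists_isRegular_gt P.kappa).imp fun χ ⟨hχ, hκ⟩ => ⟨hχ, hκ, h χ hχ hκ⟩
  tfae_have 3 → 5 := fun h χ hχ hκ =>
    have hκ' := (Cardinal.cantor _).trans hκ
    SepPrinciple.SetPoset.nonempty_models_of_isStationary hκ' (h χ hχ hκ')
  tfae_have 5 → 4 := fun h =>
    (SepPrinciple.exists_isRegular_gt (2 ^ P.kappa)).imp fun χ ⟨hχ, hκ⟩ => ⟨hχ, hκ, h χ hχ hκ⟩
  tfae_finish
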